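/- **Setting.** For a positive semi-definite (resp. definite) symmetric matrix write $\succeq 0$ (resp. $\succ 0$); $\otimes$ is the Kronecker product; $(*)\,S\,W$ stands for $W^TSW$. For $0<m\le L$ let $\mathcal S(m,L)$ be the set of continuously differentiable $f:\mathbb R^{Nd}\to\mathbb R$ with $m\|y_1-y_2\|^2\le(\nabla f(y_1)-\nabla f(y_2))^T(y_1-y_2)\le L\|y_1-y_2\|^2$ for all $y_1,y_2$. *Plant.* Each of $N$ agents has the parameter-dependent matrices $$A_G(\rho)=\begin{bmatrix}A(\rho)&B_q(\rho)&B_p(\rho)\\0&0&I_d\\0&0&-k_dI_d\end{bmatrix},\quad B_G(\rho)=\begin{bmatrix}0\\0\\-k_pI_d\end{bmatrix},\quad C_G(\rho)=\begin{bmatrix}C(\rho)&0&0\end{bmatrix},$$ with $\rho$ in a set $\mathcal P\subseteq\mathbb R^{n_\rho}$ on which $C$ is bounded (as it is when $\mathcal P$ is compact and $C$ is continuous), and $k_d,k_p\in\mathbb R$. Assume that for every $y_{i*}\in\mathbb R^d$ there is $\eta_{i*}$ with $A_G(\rho)\eta_{i*}=0$ and $C_G(\rho)\eta_{i*}=y_{i*}$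 for all $\rho\in\mathcal P$. For $\bar\rho=(\bar\rho_1,\dots,\bar\rho_N)\in\mathcal P^N$ let $\hat A_G(\bar\rho)=\mathrm{blkdiag}(A_G(\bar\rho_1),\dots,A_G(\bar\rho_N))$, and similarly $\hat B_G,\hat C_G$. The noisy closed loop is $$\dot\eta=\hat A_G(\rho)\eta+\hat B_G(\rho)u+\hat B_G(\rho)e,\qquad y=\hat C_G(\rho)\eta,\qquad u=\nabla f(y),\qquad t\ge 0,$$ with $\rho:[0,\infty)\to\mathcal P^N$, where $\eta$ is locally absolutely continuous, the differential equation holds for almost every $t$, and $y$ is measurable. *Multipliers.* Let $\nu\ge1$, $\beta=-1$, let $A_\nu\in\mathbb R^{\nu\times\nu}$ have $\beta$ on the diagonal, $1$ on the first subdiagonal and $0$ elsewhere, $B_\nu=(1,0,\dots,0)^T\in\mathbb R^\nu$ and, for $\alpha>0$, $A_\nu^\alpha=A_\nu-2\alpha I$. Let $\Pi=\pi_{m,L}\otimes I_{Nd}$ (each of the four matrices is tensored with $I_{Nd}$), where $$\pi_{m,L}=\left[\begin{array}{cc|cc}A_\nu^\alpha&0&-mB_\nu&B_\nu\\0&A_\nu^\alpha&LB_\nu&-B_\nu\\\hline0&0&-m&1\\I_\nu&0&0&0\\0&0&L&-1\\0&I_\nu&0&0\end{array}\right].$$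 Let $R_\nu=\mathrm{diag}(1/\sqrt{0!},\dots,1/\sqrt{(\nu-1)!})$ and let $(\tilde A_\nu,\tilde B_\nu,\tilde C_\nu,\tilde D_\nu)$ be a realization with $\nu-1$ states of the transfer vector $\big[\tfrac{1}{(s-\beta)^{\nu-1}},\tfrac{s}{(s-\beta)^{\nu-1}},\dots,\tfrac{s^{\nu-1}}{(s-\beta)^{\nu-1}}\big]^T$. The set $\mathbb P$ consists of all matrices $$P=\begin{bmatrix}0&0&H&-P_3\\0&0&-P_1^T&0\\ *&*&0&0\\ *&*&0&0\end{bmatrix}\quad\text{(symmetric)},\qquad H\in\mathbb R,\ P_1,P_3\in\mathbb R^{1\times\nu},$$ such that $H+(P_1+P_3)A_\nu^{-1}B_\nu\ge0$ and, for $i\in\{1,3\}$ and some symmetric $\mathcal X_i\in\mathbb R^{(\nu-1)\times(\nu-1)}$, $$(*)\begin{bmatrix}0&\mathcal X_i&0\\\mathcal X_i&0&0\\0&0&\mathrm{diag}(P_i)\end{bmatrix}\begin{bmatrix}I&0\\\tilde A_\nu&\tilde B_\nu\\R_\nu\tilde C_\nu&R_\nu\tilde D_\nu\end{bmatrix}\succ0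 .$$ *LMI matrices.* For $\bar\rho\in\mathcal P^N$ define by series connection $$\left[\begin{array}{c|c}\mathcal A(\bar\rho)&\mathcal B(\bar\rho)\\\hline\mathcal C_1(\bar\rho)&\mathcal D_1\\\mathcal C_2&\mathcal D_2\end{array}\right]=\begin{bmatrix}\Pi&\\&I_{2Nd}\end{bmatrix}\left[\begin{array}{c|cc}\hat A_G(\bar\rho)&\hat B_G(\bar\rho)&\hat B_G(\bar\rho)\\\hline\hat C_G(\bar\rho)&0&0\\0&I_{Nd}&0\\\hline0&0&I_{Nd}\\0&I_{Nd}&0\end{array}\right],\qquad M=\begin{bmatrix}-1&0\\0&\delta^2\end{bmatrix}.$$ **Theorem.** Let $0<m\le L$ and $\delta\ge0$. Suppose there exist $\mathcal X\succ0$, $P\in\mathbb P$, $\alpha>0$ and $\lambda\ge0$ such that for all $\bar\rho\in\mathcal P^N$ $$\begin{bmatrix}\mathcal A(\bar\rho)^T\mathcal X+\mathcal X\mathcal A(\bar\rho)+2\alpha\mathcal X&\mathcal X\mathcal B(\bar\rho)\\\mathcal B(\bar\rho)^T\mathcal X&0\end{bmatrix}+(*)\begin{bmatrix}P\otimes I_{Nd}&\\&\lambda(M\otimes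 I_{Nd})\end{bmatrix}\begin{bmatrix}\mathcal C_1(\bar\rho)&\mathcal D_1\\\mathcal C_2&\mathcal D_2\end{bmatrix}\preceq0 .$$ Then every $f\in\mathcal S(m,L)$ has a unique minimizer $y_*$, and for every trajectory $(\eta,u,e,y,\rho)$ of the noisy closed loop with $\rho:[0,\infty)\to\mathcal P^N$ and $\|e(t)\|\le\delta\|\nabla f(y(t))\|$ for all $t\ge0$ there exists $\kappa\ge0$ such that $\|y(t)-y_*\|\le\kappa e^{-\alpha t}$ for all $t\ge0$. -/

import Mathlib

open Matrix MeasureTheory Set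
open scoped Kronecker

noncomputable section

namespace SourceSeeking

/-! ### Objective functions -/

/-- The class `𝒮(m, L)` on a finite-dimensional Euclidean space: continuously differentiable functions
whose gradient satisfies the two-sided monotonicity bound with constants `m` and `L`. -/
def SmL {ι : Type*} [Fintype ι] (m L : ℝ) : Set (EuclideanSpace ℝ ι → ℝ) :=
  {f | ContDiff ℝ 1 f ∧ ∀ y₁ y₂ : EuclideanSpace ℝ ι,
    m * ‖y₁ - y₂‖ ^ 2 ≤ inner ℝ (gradient f y₁ - gradient f y₂) (y₁ - y₂) ∧
    inner ℝ (gradient f y₁ - gradient f y₂) (y₁ - y₂) ≤ L * ‖y₁ - y₂‖ ^ 2}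

/-! ### The LPV vehicle and the network of `N` vehicles -/

/-- Index set of the state `(x_i, q_i, p_i)` of one agent. -/
abbrev AgentState (nx d : ℕ) : Type := Fin nx ⊕ (Fin d ⊕ Fin d)

/-- Index set of the stacked state of all `N` agents. -/
abbrev NetState (N nx d : ℕ) : Type := AgentState nx d × Fin N

/-- Index set of the stacked positions (and inputs) of all `N` agents. -/
abbrev NetPos (N d : ℕ) : Type := Fin d × Fin N

/-- The space `ℝ^{Nd}` of stacked positions, with the Euclidean norm. -/
abbrev PosSpace (N d : ℕ) : Type := EuclideanSpace ℝ (NetPos N d)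

/-- Data of the LPV model of a vehicle with local tracking controller,
`ẋ = A(ρ) x + B_q(ρ) q + B_p(ρ) p`, `y = C(ρ) x`, together with the gains of the second order dynamics
`q̇ = p`, `ṗ = - k_d p - k_p u` generating its references. -/
structure Vehicle (nρ nx d : ℕ) where
  /-- state matrix -/
  A : (Fin nρ → ℝ) → Matrix (Fin nx) (Fin nx) ℝ
  /-- input matrix of the position reference -/
  Bq : (Fin nρ → ℝ) → Matrix (Fin nx) (Fin d) ℝ
  /-- input matrix of the velocity reference -/
  Bp : (Fin nρ → ℝ) → Matrix (Fin nx) (Fin d) ℝ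
  /-- output matrix -/
  C : (Fin nρ → ℝ) → Matrix (Fin d) (Fin nx) ℝ
  /-- damping gain -/
  kd : ℝ
  /-- gradient gain -/
  kp : ℝ

namespace Vehicle

variable {nρ nx d : ℕ} (G : Vehicle nρ nx d)

/-- `A_G(ρ) = [A(ρ) B_q(ρ) B_p(ρ); 0 0 I; 0 0 -k_d I]`. -/
def AG (r : Fin nρ → ℝ) : Matrix (AgentState nx d) (AgentState nx d) ℝ :=
  fromBlocks (G.A r) (fromCols (G.Bq r) (G.Bp r)) 0 (fromBlocks 0 1 0 ((-G.kd) • 1))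

/-- `B_G(ρ) = [0; 0; -k_p I]`. -/
def BG (_r : Fin nρ → ℝ) : Matrix (AgentState nx d) (Fin d) ℝ :=
  fromRows 0 (fromRows 0 ((-G.kp) • 1))

/-- `C_G(ρ) = [C(ρ) 0 0]`. -/
def CG (r : Fin nρ → ℝ) : Matrix (Fin d) (AgentState nx d) ℝ :=
  fromCols (G.C r) 0

/-- `Â_G(ρ) = blkdiag(A_G(ρ₁), …, A_G(ρ_N))`. -/
def Ahat {N : ℕ} (r : Fin N → Fin nρ → ℝ) : Matrix (NetState N nx d) (NetState N nx d) ℝ :=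
  blockDiagonal fun i => G.AG (r i)

/-- `B̂_G(ρ) = blkdiag(B_G(ρ₁), …, B_G(ρ_N))`. -/
def Bhat {N : ℕ} (r : Fin N → Fin nρ → ℝ) : Matrix (NetState N nx d) (NetPos N d) ℝ :=
  blockDiagonal fun i => G.BG (r i)

/-- `Ĉ_G(ρ) = blkdiag(C_G(ρ₁), …, C_G(ρ_N))`. -/
def Chat {N : ℕ} (r : Fin N → Fin nρ → ℝ) : Matrix (NetPos N d) (NetState N nx d) ℝ :=
  blockDiagonal fun i => G.CG (r i)

/-- Every position `y` of an agent is the output of an equilibrium of the unforced agent dynamics,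
the same equilibrium for all parameter values in `Par`. -/
def HasEquilibria (Par : Set (Fin nρ → ℝ)) : Prop :=
  ∀ y : Fin d → ℝ, ∃ η : AgentState nx d → ℝ, ∀ r ∈ Par, G.AG r *ᵥ η = 0 ∧ G.CG r *ᵥ η = y

/-- `(η, u, e, y, ρ)` is a trajectory on `[0, ∞)` of the closed loop
`η̇ = Â_G(ρ) η + B̂_G(ρ) u + B̂_G(ρ) e`, `y = Ĉ_G(ρ) η`, `u = ∇f(y)`, with `ρ(t) ∈ Par^N`.
Solutions are understood in the sense of Carathéodory: `η` is locally absolutely continuous and satisfies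
the differential equation at almost every time. -/
structure IsTrajectory {N : ℕ} (Par : Set (Fin nρ → ℝ)) (f : PosSpace N d → ℝ)
    (η : ℝ → NetState N nx d → ℝ) (u e y : ℝ → PosSpace N d) (ρ : ℝ → Fin N → Fin nρ → ℝ) : Prop where
  param_mem : ∀ t, 0 ≤ t → ∀ i, ρ t i ∈ Par
  measurable_output : AEStronglyMeasurable y (volume.restrict (Ici (0 : ℝ)))
  absolutelyContinuous : ∀ T, 0 ≤ T → AbsolutelyContinuousOnInterval η 0 T
  dynamics : ∀ᵐ t ∂(volume.restrict (Ioi (0 : ℝ))), HasDerivAt η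
    (G.Ahat (ρ t) *ᵥ η t + G.Bhat (ρ t) *ᵥ (u t).ofLp + G.Bhat (ρ t) *ᵥ (e t).ofLp) t
  output : ∀ t, 0 ≤ t → y t = WithLp.toLp 2 (G.Chat (ρ t) *ᵥ η t)
  input : ∀ t, 0 ≤ t → u t = gradient f (y t)

end Vehicle

/-! ### Zames–Falb multipliers -/

/-- The pole of the multiplier basis functions. -/
def β : ℝ := -1

/-- `A_ν`: the lower bidiagonal matrix with `β` on the diagonal and `1` below it. -/
def Anu (ν : ℕ) : Matrix (Fin ν) (Fin ν) ℝ :=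
  Matrix.of fun i j => if i = j then β else if (i : ℕ) = j + 1 then 1 else 0

/-- `B_ν = (1, 0, …, 0)ᵀ`. -/
def Bnu (ν : ℕ) : Matrix (Fin ν) Unit ℝ :=
  Matrix.of fun i _ => if (i : ℕ) = 0 then 1 else 0

/-- `A_ν^α = A_ν - 2 α I`. -/
def AnuAlpha (ν : ℕ) (α : ℝ) : Matrix (Fin ν) (Fin ν) ℝ := Anu ν - (2 * α) • 1

/-- Index set of the output of `π_{m,L}`: two scalar channels, each followed by `ν` filter states. -/
abbrev MultOut (ν : ℕ) : Type := (Unit ⊕ Fin ν) ⊕ (Unit ⊕ Fin ν)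

/-- State matrix of `π_{m,L}`. -/
def piA (ν : ℕ) (α : ℝ) : Matrix (Fin ν ⊕ Fin ν) (Fin ν ⊕ Fin ν) ℝ :=
  fromBlocks (AnuAlpha ν α) 0 0 (AnuAlpha ν α)

/-- Input matrix of `π_{m,L}`; the two inputs are the `y`- and the `u`-channel. -/
def piB (ν : ℕ) (m L : ℝ) : Matrix (Fin ν ⊕ Fin ν) (Unit ⊕ Unit) ℝ :=
  fromBlocks ((-m) • Bnu ν) (Bnu ν) (L • Bnu ν) (-Bnu ν)

/-- Output matrix of `π_{m,L}`. -/
def piC (ν : ℕ) : Matrix (MultOut ν) (Fin ν ⊕ Fin ν) ℝ :=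
  fromBlocks (fromRows 0 1) 0 0 (fromRows 0 1)

/-- Feedthrough matrix of `π_{m,L}`. -/
def piD (ν : ℕ) (m L : ℝ) : Matrix (MultOut ν) (Unit ⊕ Unit) ℝ :=
  fromBlocks (fromRows ((-m) • 1) 0) (fromRows 1 0) (fromRows (L • 1) 0) (fromRows (-1) 0)

/-- `(Ã, B̃, C̃, D̃)` is a state-space realization, with `k = ν - 1` states, of the transfer vector with
entries `s ^ j / (s - β) ^ (ν - 1)`, `j = 0, …, ν - 1`. -/
def IsBasisRealization (k : ℕ) (At : Matrix (Fin k) (Fin k) ℝ) (Bt : Matrix (Fin k) Unit ℝ)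
    (Ct : Matrix (Fin (k + 1)) (Fin k) ℝ) (Dt : Matrix (Fin (k + 1)) Unit ℝ) : Prop :=
  ∀ s : ℂ, s ≠ (β : ℂ) →
    (s • (1 : Matrix (Fin k) (Fin k) ℂ) - At.map Complex.ofReal).det ≠ 0 ∧
    Ct.map Complex.ofReal * (s • (1 : Matrix (Fin k) (Fin k) ℂ) - At.map Complex.ofReal)⁻¹
        * Bt.map Complex.ofReal + Dt.map Complex.ofReal
      = Matrix.of fun (j : Fin (k + 1)) _ => s ^ (j : ℕ) / (s - (β : ℂ)) ^ k

/-- `R_ν = diag(1/√0!, …, 1/√(ν-1)!)`. -/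
def Rnu (ν : ℕ) : Matrix (Fin ν) (Fin ν) ℝ :=
  diagonal fun j => 1 / Real.sqrt ((j : ℕ).factorial : ℝ)

/-- The outer factor `[I 0; Ã B̃; R_ν C̃ R_ν D̃]` of the positivity condition. -/
def posOuter {k : ℕ} (At : Matrix (Fin k) (Fin k) ℝ) (Bt : Matrix (Fin k) Unit ℝ)
    (Ct : Matrix (Fin (k + 1)) (Fin k) ℝ) (Dt : Matrix (Fin (k + 1)) Unit ℝ) :
    Matrix (Fin k ⊕ (Fin k ⊕ Fin (k + 1))) (Fin k ⊕ Unit) ℝ :=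
  fromRows (fromCols 1 0) (fromRows (fromCols At Bt) (fromCols (Rnu (k + 1) * Ct) (Rnu (k + 1) * Dt)))

/-- The middle matrix `[0 X 0; X 0 0; 0 0 diag(p)]` of the positivity condition. -/
def posMiddle {k : ℕ} (X : Matrix (Fin k) (Fin k) ℝ) (p : Fin (k + 1) → ℝ) :
    Matrix (Fin k ⊕ (Fin k ⊕ Fin (k + 1))) (Fin k ⊕ (Fin k ⊕ Fin (k + 1))) ℝ :=
  fromBlocks 0 (fromCols X 0) (fromRows X 0) (fromBlocks 0 0 0 (diagonal p))

/-- The matrix `[0 0 H -P₃; 0 0 -P₁ᵀ 0; * * 0 0; * * 0 0]`, with `P₁`, `P₃` rows of length `ν`. -/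
def multMatrix {ν : ℕ} (H : ℝ) (P₁ P₃ : Fin ν → ℝ) : Matrix (MultOut ν) (MultOut ν) ℝ :=
  let Q : Matrix (Unit ⊕ Fin ν) (Unit ⊕ Fin ν) ℝ :=
    fromBlocks (Matrix.of fun _ _ => H) (-(Matrix.of fun _ j => P₃ j)) (-(Matrix.of fun i _ => P₁ i)) 0
  fromBlocks 0 Q Qᵀ 0

/-- The set `ℙ` of Zames–Falb multipliers of order `ν = k + 1`. -/
def zamesFalb (k : ℕ) : Set (Matrix (MultOut (k + 1)) (MultOut (k + 1)) ℝ) :=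
  {P | ∃ (H : ℝ) (P₁ P₃ : Fin (k + 1) → ℝ) (X₁ X₃ : Matrix (Fin k) (Fin k) ℝ)
      (At : Matrix (Fin k) (Fin k) ℝ) (Bt : Matrix (Fin k) Unit ℝ)
      (Ct : Matrix (Fin (k + 1)) (Fin k) ℝ) (Dt : Matrix (Fin (k + 1)) Unit ℝ),
    IsBasisRealization k At Bt Ct Dt ∧
    0 ≤ H + ∑ j, (P₁ j + P₃ j) * ((Anu (k + 1))⁻¹ * Bnu (k + 1)) j () ∧
    X₁.IsSymm ∧ X₃.IsSymm ∧
    ((posOuter At Bt Ct Dt)ᵀ * posMiddle X₁ P₁ * posOuter At Bt Ct Dt).PosDef ∧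
    ((posOuter At Bt Ct Dt)ᵀ * posMiddle X₃ P₃ * posOuter At Bt Ct Dt).PosDef ∧
    P = multMatrix H P₁ P₃}

/-! ### The linear matrix inequality -/

/-- Identification of two stacked copies of an index set `ι` with the index set of `M ⊗ I` for `2 × 2`
matrices `M`. -/
def stack {ι : Type*} : ι ⊕ ι → (Unit ⊕ Unit) × ι :=
  Sum.elim (fun a => (Sum.inl (), a)) (fun a => (Sum.inr (), a))

/-- Index set of the state of the interconnection of the network with `Π = π_{m,L} ⊗ I_{Nd}`. -/
abbrev FullState (ν N nx d : ℕ) : Type := NetState N nx d ⊕ ((Fin ν ⊕ Fin ν) × NetPos N d)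

section LMI

variable {nρ nx d N : ℕ} (G : Vehicle nρ nx d) (ν : ℕ) (m L α δ : ℝ) (r : Fin N → Fin nρ → ℝ)

/-- State matrix of `Π`. -/
def PiA (N d : ℕ) : Matrix ((Fin ν ⊕ Fin ν) × NetPos N d) ((Fin ν ⊕ Fin ν) × NetPos N d) ℝ :=
  piA ν α ⊗ₖ (1 : Matrix (NetPos N d) (NetPos N d) ℝ)

/-- Input matrix of `Π`, the input being the stacked vector `(y, u)`. -/
def PiB (N d : ℕ) : Matrix ((Fin ν ⊕ Fin ν) × NetPos N d) (NetPos N d ⊕ NetPos N d) ℝ :=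
  (piB ν m L ⊗ₖ (1 : Matrix (NetPos N d) (NetPos N d) ℝ)).submatrix id stack

/-- Output matrix of `Π`. -/
def PiC (N d : ℕ) : Matrix (MultOut ν × NetPos N d) ((Fin ν ⊕ Fin ν) × NetPos N d) ℝ :=
  piC ν ⊗ₖ (1 : Matrix (NetPos N d) (NetPos N d) ℝ)

/-- Feedthrough matrix of `Π`, the input being the stacked vector `(y, u)`. -/
def PiD (N d : ℕ) : Matrix (MultOut ν × NetPos N d) (NetPos N d ⊕ NetPos N d) ℝ :=
  (piD ν m L ⊗ₖ (1 : Matrix (NetPos N d) (NetPos N d) ℝ)).submatrix id stack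

/-- Input matrix `[B̂_G B̂_G]` of the plant with input `(u, e)`. -/
def plantB : Matrix (NetState N nx d) (NetPos N d ⊕ NetPos N d) ℝ :=
  fromCols (G.Bhat r) (G.Bhat r)

/-- State-to-`(y, u)` matrix `[Ĉ_G; 0]` of the plant. -/
def plantC : Matrix (NetPos N d ⊕ NetPos N d) (NetState N nx d) ℝ :=
  fromRows (G.Chat r) 0

/-- `(u, e)`-to-`(y, u)` matrix `[0 0; I 0]` of the plant. -/
def plantD (N d : ℕ) : Matrix (NetPos N d ⊕ NetPos N d) (NetPos N d ⊕ NetPos N d) ℝ :=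
  fromBlocks 0 0 1 0

/-- `𝒜(ρ)` of the series connection of the plant with `blkdiag(Π, I_{2Nd})`. -/
def calA : Matrix (FullState ν N nx d) (FullState ν N nx d) ℝ :=
  fromBlocks (G.Ahat r) 0 (PiB ν m L N d * plantC G r) (PiA ν α N d)

/-- `ℬ(ρ)` of the series connection. -/
def calB : Matrix (FullState ν N nx d) (NetPos N d ⊕ NetPos N d) ℝ :=
  fromRows (plantB G r) (PiB ν m L N d * plantD N d)

/-- `𝒞₁(ρ)` of the series connection. -/
def calC₁ : Matrix (MultOut ν × NetPos N d) (FullState ν N nx d) ℝ :=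
  fromCols (PiD ν m L N d * plantC G r) (PiC ν N d)

/-- `𝒟₁` of the series connection. -/
def calD₁ (N d : ℕ) : Matrix (MultOut ν × NetPos N d) (NetPos N d ⊕ NetPos N d) ℝ :=
  PiD ν m L N d * plantD N d

/-- `𝒞₂ = 0`, the map from the state to `(e, u)`. -/
def calC₂ (N nx d : ℕ) : Matrix (NetPos N d ⊕ NetPos N d) (FullState ν N nx d) ℝ := 0

/-- `𝒟₂ = [0 I; I 0]`, the map from `(u, e)` to `(e, u)`. -/
def calD₂ (N d : ℕ) : Matrix (NetPos N d ⊕ NetPos N d) (NetPos N d ⊕ NetPos N d) ℝ :=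
  fromBlocks 0 1 1 0

/-- The noise multiplier `M = diag(-1, δ²)`. -/
def noiseM : Matrix (Unit ⊕ Unit) (Unit ⊕ Unit) ℝ :=
  fromBlocks (-1) 0 0 ((δ ^ 2) • 1)

/-- The left-hand side of the linear matrix inequality at the frozen parameter `r`. -/
def lmiMatrix (X : Matrix (FullState ν N nx d) (FullState ν N nx d) ℝ)
    (P : Matrix (MultOut ν) (MultOut ν) ℝ) (lam : ℝ) :
    Matrix (FullState ν N nx d ⊕ (NetPos N d ⊕ NetPos N d))
      (FullState ν N nx d ⊕ (NetPos N d ⊕ NetPos N d)) ℝ :=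
  let A := calA G ν m L α r
  let B := calB G ν m L r
  let W := fromBlocks (calC₁ G ν m L r) (calD₁ ν m L N d) (calC₂ ν N nx d) (calD₂ N d)
  fromBlocks (Aᵀ * X + X * A + (2 * α) • X) (X * B) (Bᵀ * X) 0
    + Wᵀ * fromBlocks (P ⊗ₖ (1 : Matrix (NetPos N d) (NetPos N d) ℝ)) 0 0
        (lam • (noiseM δ ⊗ₖ (1 : Matrix (NetPos N d) (NetPos N d) ℝ)).submatrix stack stack) * W

end LMI

end SourceSeeking

end

/-!
The minimizer exists and is unique because `f` is strongly convex and coercive. For convergence, let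
`η⋆` be the common equilibrium of the network with output `y⋆`, and run the multiplier `Π` from the
zero state along the trajectory. With `ξ` the deviation of the plant state from `η⋆` joined with the
states `ψ₁`, `ψ₂` of `Π`, and `V = ξᵀ X ξ`, the linear matrix inequality says that almost everywhere
`V' + 2 α V ≤ -2 S`, where `S = H w₁ᵀw₂ - w₁ᵀ P₃ ψ₂ - w₂ᵀ P₁ ψ₁`, `w₁ = ∇f(y) - m (y - y⋆)` and
`w₂ = L (y - y⋆) - ∇f(y)`; the noise term has the right sign (`lmi_dissipation`). As `V` is absolutely
continuous, `exp(2αT) V(T) ≤ V(0)` follows once `∫₀ᵀ exp(2αt) S(t) dt ≥ 0`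
(`exp_quadForm_le_of_dissipation`), and positive definiteness of `X` and boundedness of `C` turn this
into the decay of `y - y⋆`.

The integral inequality (`zamesFalb_iqc`) rests on two facts. First, the positivity condition
in `ℙ` evaluated at `s = iω` gives `∑ P_j t^j / j! ≥ 0` for `t ≥ 0` (`zamesFalb_poly_nonneg`), so the
impulse response `h(τ) = P exp(A_ν τ) B_ν` is nonnegative, with mass
`-P A_ν⁻¹ B_ν = ∑ P_j`. Secondly, convexity of `f - m/2 ‖·‖²` and the Lipschitz bound on its gradient
provide a storage function `q` with `0 ≤ q ≤ w₁ᵀw₂` and `w₁(x)ᵀw₂(x) - w₁(x)ᵀw₂(x') ≥ q(x) - q(x')`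
(`SmL.exists_storage`), and `w₁ᵀw₂ - q` plays the same part when `w₁` and `w₂` are exchanged. Products
at different times are thereby replaced by values of the nonnegative signal `exp(2αt) q`, which
convolution with `h` does not amplify in `L¹` beyond the factor `∑ P_j`.
-/

noncomputable section

namespace SourceSeeking

/-! ### Strongly convex functions with Lipschitz gradient -/

section Convex

variable {ι : Type*} [Fintype ι] {m L : ℝ} {f : EuclideanSpace ℝ ι → ℝ}

theorem SmL.hasDerivAt_line (hf : f ∈ SmL m L) (x v : EuclideanSpace ℝ ι) (t : ℝ) :
    HasDerivAt (fun s : ℝ => f (x + s • v)) (inner ℝ (gradient f (x + t • v)) v) t := by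
  have h1 : HasFDerivAt f (fderiv ℝ f (x + t • v)) (x + t • v) :=
    ((hf.1.differentiable (by simp)) _).hasFDerivAt
  have h2 : HasDerivAt (fun s : ℝ => x + s • v) v t := by
    simpa using ((hasDerivAt_id t).smul_const v).const_add x
  have h3 := h1.comp_hasDerivAt t h2
  rwa [← inner_gradient_left] at h3

theorem SmL.continuous_gradient (hf : f ∈ SmL m L) : Continuous (gradient f) := by
  unfold gradient
  exact (LinearIsometryEquiv.continuous _).comp (hf.1.continuous_fderiv (by simp))

/-- The first-order lower bound of an `m`-strongly convex function. -/
theorem SmL.lower_bound (hf : f ∈ SmL m L) (x z : EuclideanSpace ℝ ι) :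
    f x + inner ℝ (gradient f x) (z - x) + m / 2 * ‖z - x‖ ^ 2 ≤ f z := by
  set v := z - x with hv
  let p : ℝ → ℝ := fun t => f (x + t • v) - t * inner ℝ (gradient f x) v - m / 2 * ‖v‖ ^ 2 * t ^ 2
  have hp : ∀ t, HasDerivAt p (inner ℝ (gradient f (x + t • v) - gradient f x) v
      - m * ‖v‖ ^ 2 * t) t := by
    intro t
    have h := ((SmL.hasDerivAt_line hf x v t).sub ((hasDerivAt_id t).mul_const
      (inner ℝ (gradient f x) v))).sub ((hasDerivAt_pow 2 t).const_mul (m / 2 * ‖v‖ ^ 2))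
    refine h.congr_deriv ?_
    rw [inner_sub_left]; push_cast; ring
  have hmono : MonotoneOn p (Icc 0 1) := by
    refine monotoneOn_of_deriv_nonneg (convex_Icc 0 1)
      (fun t _ => (hp t).continuousAt.continuousWithinAt)
      (fun t _ => (hp t).differentiableAt.differentiableWithinAt) ?_
    intro t ht
    rw [interior_Icc] at ht
    rw [(hp t).deriv]
    have h := (hf.2 (x + t • v) x).1
    simp only [add_sub_cancel_left, norm_smul, inner_smul_right, mul_pow, Real.norm_eq_abs, sq_abs]
      at h
    have ht0 := ht.1
    have : 0 ≤ t * (inner ℝ (gradient f (x + t • v) - gradient f x) v - m * ‖v‖ ^ 2 * t) := by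
      nlinarith
    exact nonneg_of_mul_nonneg_right this ht0
  have h01 := hmono (left_mem_Icc.2 zero_le_one) (right_mem_Icc.2 zero_le_one) zero_le_one
  simp only [p, zero_smul, add_zero, one_smul] at h01
  have : x + v = z := by simp [hv]
  rw [this] at h01
  nlinarith

/-- The descent lemma, obtained from the lower bound for `-f ∈ 𝒮(-L, -m)`. -/
theorem SmL.upper_bound (hf : f ∈ SmL m L) (x z : EuclideanSpace ℝ ι) :
    f z ≤ f x + inner ℝ (gradient f x) (z - x) + L / 2 * ‖z - x‖ ^ 2 := by
  have hg : gradient (-f) = fun y => -gradient f y := by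
    funext y
    simp [gradient, fderiv_neg]
  have hneg : (-f) ∈ SmL (-L) (-m) := by
    refine ⟨hf.1.neg, fun y₁ y₂ => ?_⟩
    have h := hf.2 y₁ y₂
    rw [hg]
    rw [show -gradient f y₁ - -gradient f y₂ = -(gradient f y₁ - gradient f y₂) by abel,
      inner_neg_left]
    constructor <;> linarith [h.1, h.2]
  have h := SmL.lower_bound hneg x z
  rw [hg] at h
  simp only [Pi.neg_apply, inner_neg_left] at h
  linarith

theorem SmL.gradient_eq_zero {x : EuclideanSpace ℝ ι} (h : ∀ y, f x ≤ f y) : gradient f x = 0 := by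
  have : IsLocalMin f x := Filter.Eventually.of_forall h
  simp [gradient, this.fderiv_eq_zero]

theorem SmL.exists_minimizer (hm : 0 < m) (hf : f ∈ SmL m L) :
    ∃ x, (∀ y, f x ≤ f y) ∧ ∀ z, (∀ y, f z ≤ f y) → z = x := by
  have hlim : Filter.Tendsto f (Filter.cocompact _) Filter.atTop := by
    have h1 : Filter.Tendsto (fun y : EuclideanSpace ℝ ι => ‖y‖) (Filter.cocompact _) Filter.atTop :=
      tendsto_norm_cocompact_atTop
    have h2 : Filter.Tendsto (fun r : ℝ => f 0 + r * (m / 2 * r - ‖gradient f 0‖))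
        Filter.atTop Filter.atTop := by
      refine Filter.tendsto_atTop_add_const_left _ _ (Filter.tendsto_id.atTop_mul_atTop₀ ?_)
      exact Filter.tendsto_atTop_add_const_right _ _
        (Filter.tendsto_id.const_mul_atTop (by positivity))
    refine Filter.tendsto_atTop_mono (fun y => ?_) (h2.comp h1)
    have h3 := SmL.lower_bound hf 0 y
    have h4 := abs_le.1 (abs_real_inner_le_norm (gradient f 0) (y - 0))
    simp only [sub_zero] at h3 h4
    simp only [Function.comp]
    nlinarith [h4.1]
  obtain ⟨x, hx⟩ := hf.1.continuous.exists_forall_le hlim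
  refine ⟨x, hx, fun z hz => ?_⟩
  have h := (hf.2 z x).1
  rw [SmL.gradient_eq_zero hx, SmL.gradient_eq_zero hz] at h
  simp only [sub_self, inner_zero_left] at h
  have h0 : ‖z - x‖ ^ 2 = 0 := le_antisymm (by nlinarith) (sq_nonneg _)
  simpa [sub_eq_zero] using h0

/-- Interpolation inequality for `φ = f - m / 2 ‖·‖²`, which is convex with an `(L - m)`-Lipschitz
gradient: `(L - m) (φ z - φ x - ⟨∇φ x, z - x⟩) ≥ ‖∇φ z - ∇φ x‖² / 2`. It comes from comparing the lower
bound of `f` at `x` with the upper bound at `z` in the point reached from `z` by a gradient step. -/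
theorem SmL.interpolation (hmL : m ≤ L) (hf : f ∈ SmL m L) (x z : EuclideanSpace ℝ ι) :
    1 / 2 * ‖(gradient f z - m • z) - (gradient f x - m • x)‖ ^ 2 ≤
      (L - m) * ((f z - m / 2 * ‖z‖ ^ 2) - (f x - m / 2 * ‖x‖ ^ 2)
        - inner ℝ (gradient f x - m • x) (z - x)) := by
  set D := (gradient f z - m • z) - (gradient f x - m • x) with hD
  have key : ∀ τ : ℝ, (τ - (L - m) / 2 * τ ^ 2) * ‖D‖ ^ 2 ≤
      (f z - m / 2 * ‖z‖ ^ 2) - (f x - m / 2 * ‖x‖ ^ 2)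
        - inner ℝ (gradient f x - m • x) (z - x) := by
    intro τ
    have h1 := SmL.lower_bound hf x (z - τ • D)
    have h2 := SmL.upper_bound hf z (z - τ • D)
    have e : gradient f z = D + gradient f x - m • x + m • z := by rw [hD]; abel
    rw [e] at h2
    clear_value D
    generalize gradient f x = g at *
    simp only [← real_inner_self_eq_norm_sq, inner_sub_left, inner_sub_right, inner_add_left,
      inner_smul_left, inner_smul_right, RCLike.conj_to_real,
      sub_sub_cancel_left, inner_neg_right, inner_neg_left] at h1 h2 ⊢
    have c1 := real_inner_comm D z
    have c2 := real_inner_comm x z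
    have c3 := real_inner_comm D x
    simp only [c1, c2, c3] at h1 h2 ⊢
    linarith
  set R := (f z - m / 2 * ‖z‖ ^ 2) - (f x - m / 2 * ‖x‖ ^ 2)
        - inner ℝ (gradient f x - m • x) (z - x) with hR
  rcases hmL.eq_or_lt with h | h
  · subst h
    have h1 := key 1
    -- For `m = L` the bound is linear in the step length, so the gradient difference must vanish.
    have h2 := key ((R + 1) / ‖D‖ ^ 2)
    by_cases h0 : ‖D‖ ^ 2 = 0
    · rw [h0]; simp
    · simp only [sub_self, zero_div, zero_mul, sub_zero, div_mul_cancel₀ _ h0] at h2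
      linarith
  · have hK : 0 < L - m := by linarith
    have h1 := mul_le_mul_of_nonneg_left (key (1 / (L - m))) hK.le
    refine le_trans (le_of_eq ?_) h1
    field_simp
    ring

/-- With `w₁ = ∇f - m (x - x₀)` and `w₂ = L (x - x₀) - ∇f`, the function
`q = (L - m) φ - ‖∇φ‖² / 2`, `φ = f - f x₀ - m / 2 ‖· - x₀‖²`, is a storage function: the incremental
inequality is the interpolation inequality rewritten, and its cases `x = x₀` and `x' = x₀` give
`0 ≤ q ≤ ⟨w₁, w₂⟩`. -/
theorem SmL.exists_storage (hmL : m ≤ L) (hf : f ∈ SmL m L) {x₀ : EuclideanSpace ℝ ι}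
    (hx₀ : gradient f x₀ = 0) :
    ∃ q : EuclideanSpace ℝ ι → ℝ, Continuous q ∧
      (∀ x, 0 ≤ q x) ∧
      (∀ x, q x ≤ inner ℝ (gradient f x - m • (x - x₀)) (L • (x - x₀) - gradient f x)) ∧
      ∀ x x', q x - q x' ≤
        inner ℝ (gradient f x - m • (x - x₀)) (L • (x - x₀) - gradient f x) -
        inner ℝ (gradient f x - m • (x - x₀)) (L • (x' - x₀) - gradient f x') := by
  let q : EuclideanSpace ℝ ι → ℝ := fun x =>
    (L - m) * (f x - f x₀ - m / 2 * ‖x - x₀‖ ^ 2) - 1 / 2 * ‖gradient f x - m • (x - x₀)‖ ^ 2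
  have hgc := SmL.continuous_gradient hf
  have hfc := hf.1.continuous
  have main : ∀ x x', q x - q x' ≤
        inner ℝ (gradient f x - m • (x - x₀)) (L • (x - x₀) - gradient f x) -
        inner ℝ (gradient f x - m • (x - x₀)) (L • (x' - x₀) - gradient f x') := by
    intro x x'
    have h := SmL.interpolation hmL hf x x'
    simp only [q]
    generalize gradient f x = g at *
    generalize gradient f x' = g' at *
    obtain ⟨a, rfl⟩ : ∃ a, x = a + x₀ := ⟨x - x₀, by simp⟩
    obtain ⟨b, rfl⟩ : ∃ b, x' = b + x₀ := ⟨x' - x₀, by simp⟩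
    simp only [← real_inner_self_eq_norm_sq, inner_sub_left, inner_sub_right, inner_add_left,
      inner_smul_left, inner_smul_right, inner_add_right, RCLike.conj_to_real,
      add_sub_cancel_right, smul_add] at h ⊢
    have c1 := real_inner_comm g a
    have c2 := real_inner_comm g b
    have c3 := real_inner_comm g g'
    have c4 := real_inner_comm g x₀
    have c5 := real_inner_comm g' a
    have c6 := real_inner_comm g' b
    have c7 := real_inner_comm g' x₀
    have c8 := real_inner_comm a b
    have c9 := real_inner_comm a x₀
    have c10 := real_inner_comm b x₀
    simp only [c1, c2, c3, c4, c5, c6, c7, c8, c9, c10] at h ⊢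
    linarith
  have hq0 : q x₀ = 0 := by simp [q, hx₀]
  refine ⟨q, by fun_prop, fun x => ?_, fun x => ?_, main⟩
  · have h := main x₀ x
    simp only [hx₀, hq0, sub_self, smul_zero, inner_zero_left] at h
    linarith
  · have h := main x x₀
    simp only [hx₀, hq0, sub_self, smul_zero, inner_zero_right] at h
    linarith

end Convex

/-! ### Positivity of the multiplier kernels -/

section Positivity

theorem dotProduct_congruence {m n R : Type*} [Fintype m] [Fintype n] [CommRing R]
    (W : Matrix m n R) (S : Matrix m m R) (v : n → R) :
    v ⬝ᵥ (Wᵀ * S * W) *ᵥ v = (W *ᵥ v) ⬝ᵥ S *ᵥ (W *ᵥ v) := by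
  rw [Matrix.mul_assoc, ← mulVec_mulVec, ← mulVec_mulVec, dotProduct_mulVec, vecMul_transpose]

/-- The quadratic form of the positivity condition along a pair `(x, y)` of a state and its derivative
`y = Ã x + B̃ c` under the input `c`. -/
theorem posOuter_quadForm {k : ℕ} (At : Matrix (Fin k) (Fin k) ℝ) (Bt : Matrix (Fin k) Unit ℝ)
    (Ct : Matrix (Fin (k + 1)) (Fin k) ℝ) (Dt : Matrix (Fin (k + 1)) Unit ℝ)
    {X : Matrix (Fin k) (Fin k) ℝ} (hX : X.IsSymm) (p : Fin (k + 1) → ℝ) (x y : Fin k → ℝ)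
    (c : ℝ) (hy : ∀ i, (At *ᵥ x) i + Bt i () * c = y i) :
    Sum.elim x (fun _ => c) ⬝ᵥ ((posOuter At Bt Ct Dt)ᵀ * posMiddle X p * posOuter At Bt Ct Dt) *ᵥ
      Sum.elim x (fun _ => c) =
    2 * (x ⬝ᵥ X *ᵥ y) + ∑ j, p j / (j : ℕ).factorial * ((Ct *ᵥ x) j + Dt j () * c) ^ 2 := by
  have hy' : At *ᵥ x + Bt *ᵥ (fun _ => c) = y := by
    funext i
    rw [← hy i]
    simp [mulVec, dotProduct]
  have hs : y ⬝ᵥ X *ᵥ x = x ⬝ᵥ X *ᵥ y := by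
    rw [dotProduct_mulVec, dotProduct_comm, ← mulVec_transpose, hX.eq]
  rw [dotProduct_congruence]
  simp only [posOuter, posMiddle, fromRows_mulVec, fromCols_mulVec_sumElim, fromBlocks_mulVec,
    Sum.elim_comp_inl, Sum.elim_comp_inr, hy', one_mulVec, zero_mulVec, add_zero, zero_add,
    sumElim_dotProduct_sumElim, ← Sum.elim_add_add, two_mul, add_assoc]
  rw [hs]
  congr 2
  have hg : (Rnu (k + 1) * Ct) *ᵥ x + (Rnu (k + 1) * Dt) *ᵥ (fun _ => c) =
      fun j : Fin (k + 1) => 1 / Real.sqrt ((j : ℕ).factorial : ℝ) * ((Ct *ᵥ x) j + Dt j () * c) := by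
    rw [← mulVec_mulVec, ← mulVec_mulVec, ← mulVec_add, Rnu]
    funext j
    rw [mulVec_diagonal]
    simp [mulVec, dotProduct]
  rw [hg, dotProduct]
  refine Finset.sum_congr rfl fun j _ => ?_
  have h1 : Real.sqrt ((j : ℕ).factorial : ℝ) ^ 2 = ((j : ℕ).factorial : ℝ) :=
    Real.sq_sqrt (by positivity)
  have h2 : p j / ((j : ℕ).factorial : ℝ) =
      p j * (1 / Real.sqrt ((j : ℕ).factorial : ℝ)) ^ 2 := by
    rw [div_pow, h1]; ring
  rw [mulVec_diagonal, h2]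
  ring

/-- The easy direction of the Kalman–Yakubovich–Popov lemma. On the real and imaginary parts of the
complex state `(s - Ã)⁻¹ B̃` at `s = i √t` the terms with `X` cancel, and what remains is
`∑ p_j / j! |s ^ j / (s + 1) ^ k|² = (1 + t)⁻ᵏ ∑ p_j t ^ j / j!`. -/
theorem zamesFalb_poly_nonneg {k : ℕ} {At : Matrix (Fin k) (Fin k) ℝ} {Bt : Matrix (Fin k) Unit ℝ}
    {Ct : Matrix (Fin (k + 1)) (Fin k) ℝ} {Dt : Matrix (Fin (k + 1)) Unit ℝ}
    (hreal : IsBasisRealization k At Bt Ct Dt)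
    {X : Matrix (Fin k) (Fin k) ℝ} (hX : X.IsSymm) (p : Fin (k + 1) → ℝ)
    (hpos : ((posOuter At Bt Ct Dt)ᵀ * posMiddle X p * posOuter At Bt Ct Dt).PosDef)
    {t : ℝ} (ht : 0 ≤ t) : 0 ≤ ∑ j : Fin (k + 1), p j * (t ^ (j : ℕ) / (j : ℕ).factorial) := by
  set ω := Real.sqrt t with hω
  have hω2 : ω ^ 2 = t := Real.sq_sqrt ht
  set s : ℂ := ω * Complex.I with hs
  have hs1 : s ≠ (β : ℂ) := by
    intro h
    have := congrArg Complex.re h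
    simp [hs, β] at this
  obtain ⟨hdet, hG⟩ := hreal s hs1
  set S := s • (1 : Matrix (Fin k) (Fin k) ℂ) - At.map Complex.ofReal with hS
  have hx0 : S * (S⁻¹ * Bt.map Complex.ofReal) = Bt.map Complex.ofReal := by
    rw [Matrix.mul_nonsing_inv_cancel_left _ _ (isUnit_iff_ne_zero.2 hdet)]
  rw [Matrix.mul_assoc] at hG
  set x := S⁻¹ * Bt.map Complex.ofReal with hx
  clear_value x
  have hstate : ∀ i, ∑ j, (At i j : ℂ) * x j () + Bt i () = s * x i () := by
    intro i
    have := congrFun (congrFun hx0 i) ()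
    rw [hS, Matrix.sub_mul, Matrix.smul_mul, Matrix.one_mul] at this
    simp only [Matrix.sub_apply, Matrix.smul_apply, smul_eq_mul, Matrix.mul_apply,
      Matrix.map_apply] at this
    linear_combination -this
  have hout : ∀ j, ∑ i, (Ct j i : ℂ) * x i () + Dt j () = s ^ (j : ℕ) / (s - (β : ℂ)) ^ k := by
    intro j
    have := congrFun (congrFun hG j) ()
    simpa [Matrix.mul_apply] using this
  set a : Fin k → ℝ := fun i => (x i ()).re with ha
  set b : Fin k → ℝ := fun i => (x i ()).im with hb
  have hra : ∀ i, (At *ᵥ a) i + Bt i () * 1 = (-ω • b) i := by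
    intro i
    have := congrArg Complex.re (hstate i)
    simpa [mulVec, dotProduct, hs] using this
  have hrb : ∀ i, (At *ᵥ b) i + Bt i () * 0 = (ω • a) i := by
    intro i
    have := congrArg Complex.im (hstate i)
    simpa [mulVec, dotProduct, hs] using this
  have q1 := posOuter_quadForm At Bt Ct Dt hX p a _ 1 hra
  have q2 := posOuter_quadForm At Bt Ct Dt hX p b _ 0 hrb
  have n1 := hpos.posSemidef.dotProduct_mulVec_nonneg (Sum.elim a (fun _ => 1))
  have n2 := hpos.posSemidef.dotProduct_mulVec_nonneg (Sum.elim b (fun _ => 0))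
  rw [star_trivial] at n1 n2
  have hsym : b ⬝ᵥ X *ᵥ a = a ⬝ᵥ X *ᵥ b := by
    rw [dotProduct_mulVec, dotProduct_comm, ← mulVec_transpose, hX.eq]
  have habs : ∀ j : Fin (k + 1), ((Ct *ᵥ a) j + Dt j () * 1) ^ 2 + ((Ct *ᵥ b) j + Dt j () * 0) ^ 2
      = t ^ (j : ℕ) / (1 + t) ^ k := by
    intro j
    have h1 : ((Ct *ᵥ a) j + Dt j () * 1) = (s ^ (j : ℕ) / (s - (β : ℂ)) ^ k).re := by
      have := congrArg Complex.re (hout j)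
      rw [← this]
      simp [mulVec, dotProduct, ha]
    have h2 : ((Ct *ᵥ b) j + Dt j () * 0) = (s ^ (j : ℕ) / (s - (β : ℂ)) ^ k).im := by
      have := congrArg Complex.im (hout j)
      rw [← this]
      simp [mulVec, dotProduct, hb]
    rw [h1, h2, sq, sq, ← Complex.normSq_apply, map_div₀, map_pow, map_pow]
    congr 2
    · rw [← hω2]; simp [hs, Complex.normSq_apply, sq]
    · rw [← hω2]; simp [hs, Complex.normSq_apply, β, sq]
  have hsum : 0 ≤ ∑ j : Fin (k + 1), p j / (j : ℕ).factorial * (t ^ (j : ℕ) / (1 + t) ^ k) := by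
    have : ∑ j : Fin (k + 1), p j / (j : ℕ).factorial * (t ^ (j : ℕ) / (1 + t) ^ k) =
      ∑ j, p j / (j : ℕ).factorial * ((Ct *ᵥ a) j + Dt j () * 1) ^ 2 +
      ∑ j, p j / (j : ℕ).factorial * ((Ct *ᵥ b) j + Dt j () * 0) ^ 2 := by
      rw [← Finset.sum_add_distrib]
      refine Finset.sum_congr rfl fun j _ => ?_
      rw [← mul_add, habs]
    rw [this]
    simp only [mulVec_smul, dotProduct_smul, smul_eq_mul, hsym] at q1 q2
    linarith
  have hpow : 0 < (1 + t) ^ k := by positivity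
  have := mul_nonneg hsum hpow.le
  rw [Finset.sum_mul] at this
  refine this.trans_eq (Finset.sum_congr rfl fun j _ => ?_)
  field_simp

theorem Anu_mulVec_zero (k : ℕ) (v : Fin (k + 1) → ℝ) : (Anu (k + 1) *ᵥ v) 0 = -v 0 := by
  rw [mulVec, dotProduct, Finset.sum_eq_single 0]
  · simp [Anu, β]
  · intro j _ hj
    simp [Anu, hj.symm]
  · simp

theorem Anu_mulVec_succ (k : ℕ) (v : Fin (k + 1) → ℝ) (j : Fin k) :
    (Anu (k + 1) *ᵥ v) j.succ = v j.castSucc - v j.succ := by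
  have hne : j.castSucc ≠ j.succ := (Fin.castSucc_lt_succ (i := j)).ne
  rw [mulVec, dotProduct, Finset.sum_eq_add j.castSucc j.succ hne]
  · simp [Anu, β, hne.symm]; ring
  · intro i _ hi
    have h1 : ¬ j.succ = i := fun h => hi.2 h.symm
    have h2 : ¬ (j : ℕ) = i := fun h => hi.1 (Fin.ext (by simp [h]))
    simp [Anu, h1, h2]
  · simp
  · simp

theorem Anu_inv_mul_Bnu (k : ℕ) (j : Fin (k + 1)) :
    ((Anu (k + 1))⁻¹ * Bnu (k + 1)) j () = -1 := by
  have hdet : IsUnit (Anu (k + 1)).det := by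
    rw [det_of_isLowerTriangular]
    · simp [Anu, β, isUnit_iff_ne_zero]
    · intro i j hij
      have : i < j := by simpa using hij
      simp only [Anu, of_apply]
      rw [if_neg this.ne, if_neg (by have := Fin.lt_def.1 this; omega)]
  have h : Anu (k + 1) * (Matrix.of fun (_ : Fin (k + 1)) (_ : Unit) => (-1 : ℝ)) =
      Bnu (k + 1) := by
    ext i u
    have h1 : (Anu (k + 1) * (Matrix.of fun (_ : Fin (k + 1)) (_ : Unit) => (-1 : ℝ))) i u =
      (Anu (k + 1) *ᵥ fun _ => -1) i := rfl
    rw [h1]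
    refine Fin.cases ?_ (fun j => ?_) i
    · rw [Anu_mulVec_zero]; simp [Bnu]
    · rw [Anu_mulVec_succ]; simp [Bnu]
  rw [← h, Matrix.nonsing_inv_mul_cancel_left _ _ hdet]
  rfl

end Positivity

/-! ### Volterra convolutions and iterated primitives -/

section Volterra

/-- Fubini's theorem on the triangle `0 ≤ s ≤ t ≤ T` for a convolution with a continuous kernel. -/
theorem integral_convolution {h g : ℝ → ℝ} (hh : Continuous h)
    (hg : ∀ a b, IntervalIntegrable g volume a b) {T : ℝ} (hT : 0 ≤ T) :
    IntervalIntegrable (fun t => ∫ s in (0 : ℝ)..t, h (t - s) * g s) volume 0 T ∧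
    ∫ t in (0 : ℝ)..T, ∫ s in (0 : ℝ)..t, h (t - s) * g s =
      ∫ s in (0 : ℝ)..T, (∫ τ in (0 : ℝ)..(T - s), h τ) * g s := by
  let K : ℝ → ℝ → ℝ := fun t s => if s ≤ t then h (t - s) * g s else 0
  have hK : Integrable (Function.uncurry K)
      ((volume.restrict (Ioc 0 T)).prod (volume.restrict (Ioc 0 T))) := by
    have hgT : Integrable g (volume.restrict (Ioc 0 T)) :=
      (intervalIntegrable_iff_integrableOn_Ioc_of_le hT).1 (hg 0 T)
    obtain ⟨C, hC⟩ := (isCompact_Icc (a := -T) (b := T)).exists_bound_of_continuousOn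
      hh.continuousOn
    have h1 : Integrable (fun z : ℝ × ℝ => (1 : ℝ) * g z.2)
        ((volume.restrict (Ioc 0 T)).prod (volume.restrict (Ioc 0 T))) :=
      (integrable_const (1 : ℝ)).mul_prod hgT
    have hmeas : Measurable fun z : ℝ × ℝ => if z.2 ≤ z.1 then h (z.1 - z.2) else 0 :=
      Measurable.ite (measurableSet_le measurable_snd measurable_fst)
        (hh.measurable.comp (measurable_fst.sub measurable_snd)) measurable_const
    have h2 := h1.bdd_mul (c := |C|) (f := fun z : ℝ × ℝ => if z.2 ≤ z.1 then h (z.1 - z.2) else 0)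
      hmeas.aestronglyMeasurable ?_
    · refine h2.congr (Filter.Eventually.of_forall fun z => ?_)
      simp only [Function.uncurry, K]
      split_ifs <;> simp
    · rw [Measure.prod_restrict]
      refine (ae_restrict_iff' (measurableSet_Ioc.prod measurableSet_Ioc)).2
        (Filter.Eventually.of_forall fun z hz => ?_)
      obtain ⟨⟨h1, h2⟩, h3, h4⟩ := hz
      split_ifs
      · exact (hC _ ⟨by linarith, by linarith⟩).trans (le_abs_self C)
      · simp
  have hin : ∀ t ∈ Ioc 0 T, ∫ s in Ioc 0 T, K t s = ∫ s in (0 : ℝ)..t, h (t - s) * g s := by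
    intro t ht
    rw [intervalIntegral.integral_of_le ht.1.le, ← integral_indicator measurableSet_Ioc,
      ← integral_indicator measurableSet_Ioc]
    congr 1
    funext s
    simp only [indicator, K, mem_Ioc]
    have := ht.2
    by_cases h0 : 0 < s <;> by_cases h1 : s ≤ t <;> by_cases h2 : s ≤ T <;>
      simp [h0, h1, h2]
    linarith
  have hout : ∀ s ∈ Ioc 0 T, ∫ t in Ioc 0 T, K t s = (∫ τ in (0 : ℝ)..(T - s), h τ) * g s := by
    intro s hs
    have e1 : ∫ τ in (0 : ℝ)..(T - s), h τ = ∫ t in s..T, h (t - s) := by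
      rw [intervalIntegral.integral_comp_sub_right (fun x => h x) s, sub_self]
    rw [e1, ← intervalIntegral.integral_mul_const, intervalIntegral.integral_of_le hs.2,
      ← integral_indicator measurableSet_Ioc, ← integral_indicator measurableSet_Ioc]
    refine integral_congr_ae ?_
    have hne : ∀ᵐ t : ℝ, t ≠ s := by simp [ae_iff, measure_singleton]
    filter_upwards [hne] with t hts
    simp only [indicator, K, mem_Ioc]
    have := hs.1
    by_cases h0 : s < t
    · by_cases h2 : t ≤ T <;> simp [h0, h0.le, h2, this.trans h0]
    · have h1 : ¬ s ≤ t := fun h => h0 (lt_of_le_of_ne h hts.symm)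
      simp [h0, h1]
  constructor
  · rw [intervalIntegrable_iff_integrableOn_Ioc_of_le hT]
    refine hK.integral_prod_left.congr ?_
    exact (ae_restrict_iff' measurableSet_Ioc).2 (Filter.Eventually.of_forall hin)
  · rw [intervalIntegral.integral_of_le hT, intervalIntegral.integral_of_le hT,
      ← setIntegral_congr_fun measurableSet_Ioc hin, ← setIntegral_congr_fun measurableSet_Ioc hout]
    exact integral_integral_swap hK

/-- The `(j + 1)`-fold iterated primitive of `g`, all primitives vanishing at `0`. -/
def iterIntegral (g : ℝ → ℝ) : ℕ → ℝ → ℝ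
  | 0 => fun t => ∫ s in (0 : ℝ)..t, g s
  | j + 1 => fun t => ∫ s in (0 : ℝ)..t, iterIntegral g j s

variable {g : ℝ → ℝ}

theorem iterIntegral_continuous (hg : ∀ a b, IntervalIntegrable g volume a b) (j : ℕ) :
    Continuous (iterIntegral g j) := by
  induction j with
  | zero => exact intervalIntegral.continuous_primitive hg 0
  | succ j ih => exact intervalIntegral.continuous_primitive (fun a b => ih.intervalIntegrable a b) 0

theorem iterIntegral_absolutelyContinuous (hg : ∀ a b, IntervalIntegrable g volume a b) (j : ℕ)
    (T : ℝ) : AbsolutelyContinuousOnInterval (iterIntegral g j) 0 T := by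
  cases j with
  | zero => exact (hg 0 T).absolutelyContinuousOnInterval_intervalIntegral left_mem_uIcc
  | succ j => exact ((iterIntegral_continuous hg j).intervalIntegrable 0
      T).absolutelyContinuousOnInterval_intervalIntegral left_mem_uIcc

theorem iterIntegral_succ_hasDerivAt (hg : ∀ a b, IntervalIntegrable g volume a b) (j : ℕ) (t : ℝ) :
    HasDerivAt (iterIntegral g (j + 1)) (iterIntegral g j t) t :=
  (iterIntegral_continuous hg j).integral_hasStrictDerivAt 0 t |>.hasDerivAt

theorem iterIntegral_zero_ae_hasDerivAt (hg : ∀ a b, IntervalIntegrable g volume a b) :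
    ∀ᵐ t, HasDerivAt (iterIntegral g 0) (g t) t := by
  have hloc : LocallyIntegrable g volume := by
    intro x
    refine ⟨Icc (x - 1) (x + 1), Icc_mem_nhds (by linarith) (by linarith), ?_⟩
    exact (intervalIntegrable_iff_integrableOn_Icc_of_le (by linarith)).1 (hg _ _)
  filter_upwards [LocallyIntegrable.ae_hasDerivAt_integral hloc] with t ht
  exact ht 0

/-- Cauchy's formula for iterated primitives. -/
theorem iterIntegral_eq (hg : ∀ a b, IntervalIntegrable g volume a b) (j : ℕ) {t : ℝ} (ht : 0 ≤ t) :
    iterIntegral g j t = ∫ s in (0 : ℝ)..t, (t - s) ^ j / (j.factorial : ℝ) * g s := by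
  induction j generalizing t with
  | zero => simp [iterIntegral]
  | succ j ih =>
    have h1 : iterIntegral g (j + 1) t =
        ∫ r in (0 : ℝ)..t, ∫ s in (0 : ℝ)..r, (r - s) ^ j / (j.factorial : ℝ) * g s := by
      refine intervalIntegral.integral_congr fun r hr => ?_
      rw [uIcc_of_le ht] at hr
      exact ih hr.1
    rw [h1, (integral_convolution (h := fun τ => τ ^ j / (j.factorial : ℝ)) (by fun_prop) hg ht).2]
    refine intervalIntegral.integral_congr fun s _ => ?_
    rw [intervalIntegral.integral_div, integral_pow, Nat.factorial_succ]
    push_cast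
    field_simp
    simp

end Volterra

/-! ### The exponential filter and its impulse response -/

section Filter

/-- The `j`-th state of the filter `ψ₀' = -c ψ₀ + w`, `ψ_{j+1}' = -c ψ_{j+1} + ψ_j` started at zero.
The factor `exp (c t)` turns the chain into one of pure integrators, so the states are iterated
primitives of `exp (c s) w s`. -/
def filterState (c : ℝ) (w : ℝ → ℝ) (j : ℕ) (t : ℝ) : ℝ :=
  Real.exp (-c * t) * iterIntegral (fun s => Real.exp (c * s) * w s) j t

variable {w : ℝ → ℝ} {c : ℝ}

theorem intervalIntegrable_exp_mul (hw : ∀ a b, IntervalIntegrable w volume a b) (c a b : ℝ) :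
    IntervalIntegrable (fun s => Real.exp (c * s) * w s) volume a b :=
  (hw a b).continuousOn_mul (by fun_prop)

theorem filterState_continuous (hw : ∀ a b, IntervalIntegrable w volume a b) (j : ℕ) :
    Continuous (filterState c w j) := by
  have := iterIntegral_continuous (intervalIntegrable_exp_mul hw c) j
  unfold filterState
  fun_prop

theorem absolutelyContinuous_exp (c T : ℝ) :
    AbsolutelyContinuousOnInterval (fun t => Real.exp (c * t)) 0 T :=
  ContDiffOn.absolutelyContinuousOnInterval (by fun_prop)

theorem filterState_absolutelyContinuous (hw : ∀ a b, IntervalIntegrable w volume a b) (j : ℕ)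
    (T : ℝ) : AbsolutelyContinuousOnInterval (filterState c w j) 0 T :=
  (absolutelyContinuous_exp (-c) T).fun_mul
    (iterIntegral_absolutelyContinuous (intervalIntegrable_exp_mul hw c) j T)

theorem filterState_succ_hasDerivAt (hw : ∀ a b, IntervalIntegrable w volume a b) (j : ℕ) (t : ℝ) :
    HasDerivAt (filterState c w (j + 1))
      (-c * filterState c w (j + 1) t + filterState c w j t) t := by
  have h1 : HasDerivAt (fun t => Real.exp (-c * t)) (Real.exp (-c * t) * (-c * 1)) t :=
    ((hasDerivAt_id t).const_mul (-c)).exp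
  refine (h1.mul (iterIntegral_succ_hasDerivAt (intervalIntegrable_exp_mul hw c) j t)).congr_deriv ?_
  simp only [filterState]
  ring

theorem filterState_zero_ae_hasDerivAt (hw : ∀ a b, IntervalIntegrable w volume a b) :
    ∀ᵐ t, HasDerivAt (filterState c w 0) (-c * filterState c w 0 t + w t) t := by
  filter_upwards [iterIntegral_zero_ae_hasDerivAt (intervalIntegrable_exp_mul hw c)] with t ht
  have h1 : HasDerivAt (fun t => Real.exp (-c * t)) (Real.exp (-c * t) * (-c * 1)) t :=
    ((hasDerivAt_id t).const_mul (-c)).exp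
  refine (h1.mul ht).congr_deriv ?_
  have : Real.exp (-c * t) * Real.exp (c * t) = 1 := by rw [← Real.exp_add]; simp
  simp only [filterState]
  linear_combination w t * this

/-- The impulse response `h(τ) = P exp(A_ν τ) B_ν = exp(-τ) ∑ p_j τ ^ j / j!` of the filter
with state matrix `A_ν` and output row `P = p`. -/
def impulseResponse {k : ℕ} (p : Fin (k + 1) → ℝ) (τ : ℝ) : ℝ :=
  Real.exp (-τ) * ∑ j : Fin (k + 1), p j * (τ ^ (j : ℕ) / (j : ℕ).factorial)

theorem impulseResponse_continuous {k : ℕ} (p : Fin (k + 1) → ℝ) : Continuous (impulseResponse p) := by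
  unfold impulseResponse; fun_prop

/-- A nonnegative impulse response has total mass `∑ p_j`, by the Gamma integral, and so at most that much
on a bounded interval. -/
theorem integral_impulseResponse_le {k : ℕ} (p : Fin (k + 1) → ℝ)
    (hp : ∀ t, 0 ≤ t → 0 ≤ ∑ j : Fin (k + 1), p j * (t ^ (j : ℕ) / (j : ℕ).factorial))
    {τ : ℝ} (hτ : 0 ≤ τ) : ∫ s in (0 : ℝ)..τ, impulseResponse p s ≤ ∑ j, p j := by
  have hint : ∀ j : Fin (k + 1), IntegrableOn
      (fun s : ℝ => p j / (j : ℕ).factorial * (Real.exp (-s) * s ^ (((j : ℕ) + 1 : ℝ) - 1)))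
      (Ioi 0) := fun j => (Real.GammaIntegral_convergent (by positivity)).const_mul _
  have heq : ∀ s, impulseResponse p s =
      ∑ j : Fin (k + 1), p j / (j : ℕ).factorial *
        (Real.exp (-s) * s ^ (((j : ℕ) + 1 : ℝ) - 1)) := by
    intro s
    rw [impulseResponse, Finset.mul_sum]
    refine Finset.sum_congr rfl fun j _ => ?_
    rw [add_sub_cancel_right, Real.rpow_natCast]
    ring
  have hI : IntegrableOn (impulseResponse p) (Ioi 0) := by
    rw [funext heq]
    exact integrable_finsetSum _ fun j _ => hint j
  have hval : ∫ s in Ioi (0 : ℝ), impulseResponse p s = ∑ j, p j := by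
    simp only [heq]
    rw [integral_finsetSum _ fun j _ => hint j]
    refine Finset.sum_congr rfl fun j _ => ?_
    rw [integral_const_mul, ← Real.Gamma_eq_integral (by positivity), Real.Gamma_nat_eq_factorial]
    field_simp
  rw [intervalIntegral.integral_of_le hτ, ← hval]
  refine setIntegral_mono_set hI ?_ (Filter.Eventually.of_forall fun s hs => hs.1)
  refine (ae_restrict_iff' measurableSet_Ioi).2 (Filter.Eventually.of_forall fun s hs => ?_)
  exact mul_nonneg (Real.exp_pos _).le (hp s (le_of_lt hs))

/-- Under the weight `exp (2 α t)` the filter with state matrix `A_ν - 2 α` acts on `w` as the filter with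
state matrix `A_ν` acts on the weighted signal. -/
theorem filterState_conv {k : ℕ} (p : Fin (k + 1) → ℝ)
    (hw : ∀ a b, IntervalIntegrable w volume a b) (α : ℝ) {t : ℝ} (ht : 0 ≤ t) :
    Real.exp (2 * α * t) * ∑ j : Fin (k + 1), p j * filterState (1 + 2 * α) w j t =
      ∫ s in (0 : ℝ)..t, impulseResponse p (t - s) * (Real.exp (2 * α * s) * w s) := by
  have hI := intervalIntegrable_exp_mul hw (1 + 2 * α)
  simp only [filterState, iterIntegral_eq hI _ ht]
  rw [Finset.mul_sum]
  have e1 : ∀ j : Fin (k + 1), Real.exp (2 * α * t) * (p j * (Real.exp (-(1 + 2 * α) * t) *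
      ∫ s in (0 : ℝ)..t, (t - s) ^ (j : ℕ) / ((j : ℕ).factorial : ℝ) *
        (Real.exp ((1 + 2 * α) * s) * w s))) =
      ∫ s in (0 : ℝ)..t, Real.exp (-(t - s)) * (p j * ((t - s) ^ (j : ℕ) / (j : ℕ).factorial)) *
        (Real.exp (2 * α * s) * w s) := by
    intro j
    rw [← intervalIntegral.integral_const_mul, ← intervalIntegral.integral_const_mul,
      ← intervalIntegral.integral_const_mul]
    refine intervalIntegral.integral_congr fun s _ => ?_
    have : Real.exp (2 * α * t) * Real.exp (-(1 + 2 * α) * t) * Real.exp ((1 + 2 * α) * s) =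
        Real.exp (-(t - s)) * Real.exp (2 * α * s) := by
      simp only [← Real.exp_add]; congr 1; ring
    linear_combination (p j * ((t - s) ^ (j : ℕ) / (j : ℕ).factorial) * w s) * this
  rw [Finset.sum_congr rfl fun j _ => e1 j, ← intervalIntegral.integral_finsetSum]
  · refine intervalIntegral.integral_congr fun s _ => ?_
    simp only [impulseResponse, Finset.mul_sum, Finset.sum_mul]
  · intro j _
    exact (intervalIntegrable_exp_mul hw (2 * α) 0 t).continuousOn_mul (by fun_prop)

end Filter

/-! ### The weighted Zames–Falb integral inequality -/

section IQC

/-- Convolution with the impulse response has `L¹`-gain at most `∑ p_j` on nonnegative signals. -/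
theorem impulseResponse_conv_le {k : ℕ} (p : Fin (k + 1) → ℝ)
    (hp : ∀ t, 0 ≤ t → 0 ≤ ∑ j : Fin (k + 1), p j * (t ^ (j : ℕ) / (j : ℕ).factorial))
    {Q : ℝ → ℝ} (hQ : ∀ a b, IntervalIntegrable Q volume a b) (hQ0 : ∀ t, 0 ≤ Q t) {T : ℝ}
    (hT : 0 ≤ T) :
    ∫ t in (0 : ℝ)..T, ∫ s in (0 : ℝ)..t, impulseResponse p (t - s) * Q s ≤
      (∑ j, p j) * ∫ s in (0 : ℝ)..T, Q s := by
  rw [(integral_convolution (impulseResponse_continuous p) hQ hT).2, ← intervalIntegral.integral_const_mul]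
  refine intervalIntegral.integral_mono_on hT ?_ ((hQ 0 T).const_mul _) fun s hs => ?_
  · refine (hQ 0 T).continuousOn_mul (Continuous.continuousOn ?_)
    exact (intervalIntegral.continuous_primitive
      (fun a b => (impulseResponse_continuous p).intervalIntegrable a b) 0).comp (by fun_prop)
  · exact mul_le_mul_of_nonneg_right (integral_impulseResponse_le p hp (by linarith [hs.2])) (hQ0 s)

/-- The Zames–Falb inequality with weight `exp (2 α t)` on every finite horizon. The hypotheses on the
storage `q` bound the delayed product `x t ⬝ᵥ z s` by `(x t ⬝ᵥ z t - q t) + q s`; the first part is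
dominated because the weight is nondecreasing and the kernel has mass at most `∑ p_j`, the second one
because convolution with the kernel has `L¹`-gain at most `∑ p_j`. -/
theorem zamesFalb_iqc {ι : Type*} [Fintype ι] {k : ℕ} (p : Fin (k + 1) → ℝ)
    (hp : ∀ t, 0 ≤ t → 0 ≤ ∑ j : Fin (k + 1), p j * (t ^ (j : ℕ) / (j : ℕ).factorial))
    {α : ℝ} (hα : 0 ≤ α) (x z : ℝ → ι → ℝ) (q : ℝ → ℝ)
    (hx : ∀ i a b, IntervalIntegrable (fun t => x t i) volume a b)
    (hz : ∀ i a b, IntervalIntegrable (fun t => z t i) volume a b)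
    (hxz : ∀ a b, IntervalIntegrable (fun t => x t ⬝ᵥ z t) volume a b)
    (hq : ∀ a b, IntervalIntegrable q volume a b)
    (h0 : ∀ t, 0 ≤ q t) (h1 : ∀ t, q t ≤ x t ⬝ᵥ z t)
    (h2 : ∀ t s, q t - q s ≤ x t ⬝ᵥ z t - x t ⬝ᵥ z s) {T : ℝ} (hT : 0 ≤ T) :
    IntervalIntegrable (fun t => Real.exp (2 * α * t) * ((∑ j, p j) * (x t ⬝ᵥ z t) -
      ∑ i, x t i * ∑ j : Fin (k + 1), p j * filterState (1 + 2 * α) (fun s => z s i) j t))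
      volume 0 T ∧
    0 ≤ ∫ t in (0 : ℝ)..T, Real.exp (2 * α * t) * ((∑ j, p j) * (x t ⬝ᵥ z t) -
      ∑ i, x t i * ∑ j : Fin (k + 1), p j * filterState (1 + 2 * α) (fun s => z s i) j t) := by
  have hint : IntervalIntegrable (fun t => Real.exp (2 * α * t) * ((∑ j, p j) * (x t ⬝ᵥ z t) -
      ∑ i, x t i * ∑ j : Fin (k + 1), p j * filterState (1 + 2 * α) (fun s => z s i) j t))
      volume 0 T := by
    refine IntervalIntegrable.continuousOn_mul ?_ (by fun_prop)
    refine ((hxz 0 T).const_mul _).sub ?_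
    have : ∀ i ∈ Finset.univ, IntervalIntegrable (fun t => x t i *
        ∑ j : Fin (k + 1), p j * filterState (1 + 2 * α) (fun s => z s i) j t) volume 0 T := by
      intro i _
      refine (hx i 0 T).mul_continuousOn (Continuous.continuousOn ?_)
      exact continuous_finsetSum _ fun j _ => (filterState_continuous (hz i) j).const_mul _
    simpa only [Finset.sum_fn, dotProduct] using IntervalIntegrable.sum _ this
  refine ⟨hint, ?_⟩
  set Q : ℝ → ℝ := fun t => Real.exp (2 * α * t) * q t with hQdef
  have hQ : ∀ a b, IntervalIntegrable Q volume a b := fun a b => intervalIntegrable_exp_mul hq _ a b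
  have hQ0 : ∀ t, 0 ≤ Q t := fun t => mul_nonneg (Real.exp_pos _).le (h0 t)
  obtain ⟨hci, -⟩ := integral_convolution (impulseResponse_continuous p) hQ hT
  have hle := impulseResponse_conv_le p hp hQ hQ0 hT
  have hlow : 0 ≤ ∫ t in (0 : ℝ)..T, ((∑ j, p j) * Q t -
      ∫ s in (0 : ℝ)..t, impulseResponse p (t - s) * Q s) := by
    rw [intervalIntegral.integral_sub ((hQ 0 T).const_mul _) hci,
      intervalIntegral.integral_const_mul]
    linarith
  refine hlow.trans (intervalIntegral.integral_mono_on hT (((hQ 0 T).const_mul _).sub hci) hint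
    fun t ht => ?_)
  have ht0 := ht.1
  set B := x t ⬝ᵥ z t - q t with hB
  have hB0 : 0 ≤ B := by linarith [h1 t]
  have hexp : ∀ i a b, IntervalIntegrable (fun s => Real.exp (2 * α * s) * z s i) volume a b :=
    fun i a b => intervalIntegrable_exp_mul (hz i) _ a b
  have himp : ∀ a b, IntervalIntegrable (fun s => impulseResponse p (t - s)) volume a b :=
    fun a b => ((impulseResponse_continuous p).comp (by fun_prop)).intervalIntegrable a b
  have hcont : Continuous fun s => impulseResponse p (t - s) := (impulseResponse_continuous p).comp (by fun_prop)
  -- The filtered term is a convolution of the weighted signal.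
  have e1 : Real.exp (2 * α * t) * (∑ i, x t i *
      ∑ j : Fin (k + 1), p j * filterState (1 + 2 * α) (fun s => z s i) j t) =
      ∫ s in (0 : ℝ)..t, impulseResponse p (t - s) * (Real.exp (2 * α * s) * (x t ⬝ᵥ z s)) := by
    rw [Finset.mul_sum]
    have : ∀ i ∈ Finset.univ, Real.exp (2 * α * t) * (x t i *
        ∑ j : Fin (k + 1), p j * filterState (1 + 2 * α) (fun s => z s i) j t) =
        ∫ s in (0 : ℝ)..t, x t i * (impulseResponse p (t - s) * (Real.exp (2 * α * s) * z s i)) := by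
      intro i _
      rw [mul_left_comm, filterState_conv p (hz i) α ht0, intervalIntegral.integral_const_mul]
    rw [Finset.sum_congr rfl this, ← intervalIntegral.integral_finsetSum]
    · refine intervalIntegral.integral_congr fun s _ => ?_
      simp only [dotProduct, Finset.mul_sum]
      exact Finset.sum_congr rfl fun i _ => by ring
    · intro i _
      exact ((hexp i 0 t).continuousOn_mul hcont.continuousOn).const_mul _
  have e2 : ∫ s in (0 : ℝ)..t, impulseResponse p (t - s) * (Real.exp (2 * α * s) * (x t ⬝ᵥ z s)) ≤
      ∫ s in (0 : ℝ)..t, ((Real.exp (2 * α * t) * B) * impulseResponse p (t - s) +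
        impulseResponse p (t - s) * Q s) := by
    refine intervalIntegral.integral_mono_on ht0 ?_ ?_ fun s hs => ?_
    · have : ∀ a b, IntervalIntegrable (fun s => x t ⬝ᵥ z s) volume a b := by
        intro a b
        have : ∀ i ∈ Finset.univ, IntervalIntegrable (fun s => x t i * z s i) volume a b :=
          fun i _ => (hz i a b).const_mul _
        simpa only [Finset.sum_fn, dotProduct] using IntervalIntegrable.sum _ this
      exact (intervalIntegrable_exp_mul this _ 0 t).continuousOn_mul hcont.continuousOn
    · exact ((himp 0 t).const_mul _).add ((hQ 0 t).continuousOn_mul hcont.continuousOn)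
    · have i0 : 0 ≤ impulseResponse p (t - s) :=
        mul_nonneg (Real.exp_pos _).le (hp _ (by linarith [hs.2]))
      have a1 : Real.exp (2 * α * s) * (x t ⬝ᵥ z s) ≤ Real.exp (2 * α * t) * B + Q s := by
        have b1 : x t ⬝ᵥ z s ≤ B + q s := by linarith [h2 t s]
        have b2 : Real.exp (2 * α * s) ≤ Real.exp (2 * α * t) :=
          Real.exp_le_exp.2 (by nlinarith [hs.2])
        have b3 := mul_le_mul_of_nonneg_left b1 (Real.exp_pos (2 * α * s)).le
        have b4 := mul_le_mul_of_nonneg_right b2 hB0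
        simp only [hQdef]
        linarith
      have := mul_le_mul_of_nonneg_left a1 i0
      linarith
  rw [intervalIntegral.integral_add ((himp 0 t).const_mul _)
    ((hQ 0 t).continuousOn_mul hcont.continuousOn), intervalIntegral.integral_const_mul] at e2
  have e3 : ∫ s in (0 : ℝ)..t, impulseResponse p (t - s) ≤ ∑ j, p j := by
    rw [intervalIntegral.integral_comp_sub_left (fun s => impulseResponse p s) t, sub_self, sub_zero]
    exact integral_impulseResponse_le p hp ht0
  have e4 := mul_le_mul_of_nonneg_left e3 (mul_nonneg (Real.exp_pos (2 * α * t)).le hB0)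
  have e5 : (∑ j, p j) * Q t = (∑ j, p j) * (Real.exp (2 * α * t) * (x t ⬝ᵥ z t)) -
      Real.exp (2 * α * t) * B * ∑ j, p j := by
    simp only [hQdef, hB]; ring
  rw [mul_sub, e1]
  linarith

end IQC

/-! ### The linear matrix inequality as a dissipation inequality -/

section Dissipation

section Kron

variable {a b ι : Type*} [Fintype b] [Fintype ι] [DecidableEq ι]

theorem kronecker_one_mulVec (K : Matrix a b ℝ) (x : b × ι → ℝ) (c : a) (i : ι) :
    ((K ⊗ₖ (1 : Matrix ι ι ℝ)) *ᵥ x) (c, i) = (K *ᵥ fun c' => x (c', i)) c := by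
  simp [mulVec, dotProduct, Fintype.sum_prod_type, kroneckerMap_apply, one_apply, mul_ite]

theorem kronecker_one_quadForm [Fintype a] (P : Matrix a a ℝ) (x : a × ι → ℝ) :
    x ⬝ᵥ (P ⊗ₖ (1 : Matrix ι ι ℝ)) *ᵥ x =
      ∑ i, (fun c => x (c, i)) ⬝ᵥ P *ᵥ fun c => x (c, i) := by
  simp only [dotProduct, Fintype.sum_prod_type, kronecker_one_mulVec]
  exact Finset.sum_comm

theorem kronecker_one_stack_mulVec (K : Matrix a (Unit ⊕ Unit) ℝ) (y u : ι → ℝ) (c : a) (i : ι) :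
    ((K ⊗ₖ (1 : Matrix ι ι ℝ)).submatrix id stack *ᵥ Sum.elim y u) (c, i) =
      K c (Sum.inl ()) * y i + K c (Sum.inr ()) * u i := by
  simp only [mulVec, dotProduct, Fintype.sum_sum_type, submatrix_apply, kroneckerMap_apply,
    one_apply, stack, Sum.elim_inl, Sum.elim_inr, id, mul_ite, mul_one, mul_zero, ite_mul, zero_mul]
  congr 1 <;> rw [Finset.sum_eq_single i] <;> simp +contextual [eq_comm]

end Kron

/-- The quadratic form of `P ∈ ℙ` on the outputs `(w₁, ψ₁)` and `(w₂, ψ₂)` of the two channels. -/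
theorem multMatrix_quadForm {ν : ℕ} (H : ℝ) (P₁ P₃ : Fin ν → ℝ) (w₁ w₂ : ℝ) (ψ₁ ψ₂ : Fin ν → ℝ) :
    Sum.elim (Sum.elim (fun _ => w₁) ψ₁) (Sum.elim (fun _ => w₂) ψ₂) ⬝ᵥ
      multMatrix H P₁ P₃ *ᵥ Sum.elim (Sum.elim (fun _ => w₁) ψ₁) (Sum.elim (fun _ => w₂) ψ₂) =
    2 * (H * (w₁ * w₂) - w₁ * ∑ j, P₃ j * ψ₂ j - w₂ * ∑ j, P₁ j * ψ₁ j) := by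
  have hsymm : ∀ (Q : Matrix (Unit ⊕ Fin ν) (Unit ⊕ Fin ν) ℝ) (x z : Unit ⊕ Fin ν → ℝ),
      z ⬝ᵥ Qᵀ *ᵥ x = x ⬝ᵥ Q *ᵥ z := by
    intro Q x z
    rw [dotProduct_mulVec, dotProduct_comm, ← mulVec_transpose, transpose_transpose]
  simp only [multMatrix, fromBlocks_mulVec (A := (0 : Matrix (Unit ⊕ Fin ν) (Unit ⊕ Fin ν) ℝ)),
    Sum.elim_comp_inl, Sum.elim_comp_inr, sumElim_dotProduct_sumElim, zero_mulVec, zero_add,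
    add_zero, hsymm, ← two_mul]
  congr 1
  simp only [fromBlocks_mulVec, Sum.elim_comp_inl, Sum.elim_comp_inr,
    sumElim_dotProduct_sumElim, zero_mulVec, add_zero, neg_mulVec, dotProduct_add, dotProduct_neg]
  simp only [dotProduct, mulVec, of_apply, Finset.univ_unique, Finset.sum_singleton,
    Finset.mul_sum]
  have : ∀ j, ψ₁ j * (P₁ j * w₂) = w₂ * (P₁ j * ψ₁ j) := fun j => by ring
  simp only [this]
  ring

theorem noise_submatrix_stack (δ : ℝ) {ι : Type*} [DecidableEq ι] :
    (noiseM δ ⊗ₖ (1 : Matrix ι ι ℝ)).submatrix stack stack =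
      fromBlocks (-1) 0 0 ((δ ^ 2) • 1) := by
  ext (i | i) (j | j) <;> simp [noiseM, stack, kroneckerMap_apply, one_apply]
  split_ifs <;> simp

variable {nρ nx d N : ℕ} (G : Vehicle nρ nx d) (ν : ℕ) (m L α δ : ℝ) (r : Fin N → Fin nρ → ℝ)

theorem calA_calB_mulVec (η : NetState N nx d → ℝ) (ψ : (Fin ν ⊕ Fin ν) × NetPos N d → ℝ)
    (u e : NetPos N d → ℝ) :
    calA G ν m L α r *ᵥ Sum.elim η ψ + calB G ν m L r *ᵥ Sum.elim u e =
      Sum.elim (G.Ahat r *ᵥ η + G.Bhat r *ᵥ u + G.Bhat r *ᵥ e)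
        (PiA ν α N d *ᵥ ψ + PiB ν m L N d *ᵥ Sum.elim (G.Chat r *ᵥ η) u) := by
  simp only [calA, calB, plantB, plantC, plantD, fromBlocks_mulVec, fromRows_mulVec,
    fromCols_mulVec_sumElim, Sum.elim_comp_inl, Sum.elim_comp_inr, ← mulVec_mulVec, zero_mulVec,
    one_mulVec, add_zero, ← Sum.elim_add_add, add_assoc]
  congr 1
  rw [add_left_comm, ← mulVec_add, ← Sum.elim_add_add, add_zero, zero_add]

/-- The output of the series connection, in terms of `w₁ = u - m y` and `w₂ = L y - u`. -/
theorem output_mulVec (η : NetState N nx d → ℝ) (ψ : (Fin ν ⊕ Fin ν) × NetPos N d → ℝ)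
    (u e : NetPos N d → ℝ) :
    fromBlocks (calC₁ G ν m L r) (calD₁ ν m L N d) (calC₂ ν N nx d) (calD₂ N d) *ᵥ
      Sum.elim (Sum.elim η ψ) (Sum.elim u e) =
    Sum.elim (fun c => Sum.elim
      (Sum.elim (fun _ => u c.2 - m * (G.Chat r *ᵥ η) c.2) fun j => ψ (Sum.inl j, c.2))
      (Sum.elim (fun _ => L * (G.Chat r *ᵥ η) c.2 - u c.2) fun j => ψ (Sum.inr j, c.2)) c.1)
      (Sum.elim e u) := by
  simp only [calC₁, calD₁, calC₂, calD₂, plantC, plantD, fromBlocks_mulVec, fromRows_mulVec,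
    fromCols_mulVec_sumElim, Sum.elim_comp_inl, Sum.elim_comp_inr, ← mulVec_mulVec, zero_mulVec,
    one_mulVec, add_zero, zero_add]
  congr 1
  rw [add_right_comm, ← mulVec_add, ← Sum.elim_add_add, add_zero, zero_add]
  funext ⟨c, i⟩
  rw [Pi.add_apply, PiD, PiC, kronecker_one_stack_mulVec, kronecker_one_mulVec]
  have hC : (piC ν *ᵥ fun c' => ψ (c', i)) =
      Sum.elim (Sum.elim (0 : Unit → ℝ) fun j => ψ (Sum.inl j, i))
        (Sum.elim (0 : Unit → ℝ) fun j => ψ (Sum.inr j, i)) := by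
    rw [piC, fromBlocks_mulVec]
    simp only [fromRows_mulVec, zero_mulVec, one_mulVec, add_zero, zero_add]
    rfl
  rw [hC]
  rcases c with (c | c) | (c | c) <;> simp [piD] <;> ring

/-- The linear matrix inequality evaluated at a state and an input `(u, e)`; the term weighted by `lam`
is dropped because the noise bound makes it nonnegative. -/
theorem lmi_dissipation {ν : ℕ} {m L α δ : ℝ} {r : Fin N → Fin nρ → ℝ}
    {X : Matrix (FullState ν N nx d) (FullState ν N nx d) ℝ} (hX : X.IsSymm) {H : ℝ}
    {P₁ P₃ : Fin ν → ℝ} {lam : ℝ} (hlam : 0 ≤ lam)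
    (hLMI : (-lmiMatrix G ν m L α δ r X (multMatrix H P₁ P₃) lam).PosSemidef)
    (η : NetState N nx d → ℝ) (ψ : (Fin ν ⊕ Fin ν) × NetPos N d → ℝ) (u e y : NetPos N d → ℝ)
    (hy : y = G.Chat r *ᵥ η) (he : e ⬝ᵥ e ≤ δ ^ 2 * (u ⬝ᵥ u)) :
    Sum.elim η ψ ⬝ᵥ X *ᵥ (Sum.elim (G.Ahat r *ᵥ η + G.Bhat r *ᵥ u + G.Bhat r *ᵥ e)
        (PiA ν α N d *ᵥ ψ + PiB ν m L N d *ᵥ Sum.elim y u)) +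
      α * (Sum.elim η ψ ⬝ᵥ X *ᵥ Sum.elim η ψ) +
      ∑ i, (H * ((u i - m * y i) * (L * y i - u i)) -
        (u i - m * y i) * ∑ j, P₃ j * ψ (Sum.inr j, i) -
        (L * y i - u i) * ∑ j, P₁ j * ψ (Sum.inl j, i)) ≤ 0 := by
  have h := hLMI.dotProduct_mulVec_nonneg (Sum.elim (Sum.elim η ψ) (Sum.elim u e))
  rw [star_trivial, neg_mulVec, dotProduct_neg, lmiMatrix] at h
  simp only [add_mulVec, dotProduct_add, dotProduct_congruence, output_mulVec, ← hy] at h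
  rw [noise_submatrix_stack] at h
  have hxs : ∀ x z : FullState ν N nx d → ℝ, z ⬝ᵥ X *ᵥ x = x ⬝ᵥ X *ᵥ z := by
    intro x z
    rw [dotProduct_mulVec, dotProduct_comm, ← mulVec_transpose, hX.eq]
  have hT : ∀ {n : Type} [Fintype n] (A : Matrix (FullState ν N nx d) n ℝ)
      (x : FullState ν N nx d → ℝ) (z : n → ℝ),
      z ⬝ᵥ Aᵀ *ᵥ X *ᵥ x = x ⬝ᵥ X *ᵥ (A *ᵥ z) := by
    intro n _ A x z
    rw [← hxs, dotProduct_mulVec, vecMul_transpose]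
  have hcal := calA_calB_mulVec G ν m L α r η ψ u e
  rw [← hy] at hcal
  rw [← hcal, mulVec_add, dotProduct_add]
  set ξ := Sum.elim η ψ
  set v := Sum.elim u e
  simp only [fromBlocks_mulVec, Sum.elim_comp_inl, Sum.elim_comp_inr, zero_mulVec, add_zero,
    zero_add, sumElim_dotProduct_sumElim, add_mulVec, dotProduct_add, hT, smul_mulVec,
    dotProduct_smul, smul_eq_mul, kronecker_one_quadForm, multMatrix_quadForm, neg_mulVec,
    one_mulVec, dotProduct_neg, ← mulVec_mulVec, ← Finset.mul_sum] at h
  have hn : 0 ≤ lam * (-(e ⬝ᵥ e) + δ ^ 2 * (u ⬝ᵥ u)) := mul_nonneg hlam (by linarith)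
  linarith

theorem PiA_PiB_mulVec_zero (k : ℕ) (m L α : ℝ) (N d : ℕ)
    (ψ : (Fin (k + 1) ⊕ Fin (k + 1)) × NetPos N d → ℝ) (y u : NetPos N d → ℝ) (i : NetPos N d) :
    (PiA (k + 1) α N d *ᵥ ψ + PiB (k + 1) m L N d *ᵥ Sum.elim y u) (Sum.inl 0, i) =
      -(1 + 2 * α) * ψ (Sum.inl 0, i) + (u i - m * y i) ∧
    (PiA (k + 1) α N d *ᵥ ψ + PiB (k + 1) m L N d *ᵥ Sum.elim y u) (Sum.inr 0, i) =
      -(1 + 2 * α) * ψ (Sum.inr 0, i) + (L * y i - u i) := by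
  simp only [Pi.add_apply, PiA, PiB, kronecker_one_mulVec, kronecker_one_stack_mulVec, piA,
    fromBlocks_mulVec, Sum.elim_inl, Sum.elim_inr, zero_mulVec, add_zero, zero_add, AnuAlpha,
    sub_mulVec, Pi.sub_apply, Anu_mulVec_zero, smul_mulVec, one_mulVec, Pi.smul_apply, smul_eq_mul,
    Function.comp_apply]
  constructor <;> simp [piB, Bnu] <;> ring

theorem PiA_PiB_mulVec_succ (k : ℕ) (m L α : ℝ) (N d : ℕ)
    (ψ : (Fin (k + 1) ⊕ Fin (k + 1)) × NetPos N d → ℝ) (y u : NetPos N d → ℝ) (j : Fin k)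
    (i : NetPos N d) :
    (PiA (k + 1) α N d *ᵥ ψ + PiB (k + 1) m L N d *ᵥ Sum.elim y u) (Sum.inl j.succ, i) =
      -(1 + 2 * α) * ψ (Sum.inl j.succ, i) + ψ (Sum.inl j.castSucc, i) ∧
    (PiA (k + 1) α N d *ᵥ ψ + PiB (k + 1) m L N d *ᵥ Sum.elim y u) (Sum.inr j.succ, i) =
      -(1 + 2 * α) * ψ (Sum.inr j.succ, i) + ψ (Sum.inr j.castSucc, i) := by
  simp only [Pi.add_apply, PiA, PiB, kronecker_one_mulVec, kronecker_one_stack_mulVec, piA,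
    fromBlocks_mulVec, Sum.elim_inl, Sum.elim_inr, zero_mulVec, add_zero, zero_add, AnuAlpha,
    sub_mulVec, Pi.sub_apply, Anu_mulVec_succ, smul_mulVec, one_mulVec, Pi.smul_apply, smul_eq_mul,
    Function.comp_apply]
  constructor <;> simp [piB, Bnu] <;> ring

end Dissipation

/-! ### Absolute continuity and quadratic forms -/

section Analysis

theorem absolutelyContinuous_sum {ι : Type*} (s : Finset ι) {f : ι → ℝ → ℝ} {a b : ℝ}
    (h : ∀ i ∈ s, AbsolutelyContinuousOnInterval (f i) a b) :
    AbsolutelyContinuousOnInterval (fun t => ∑ i ∈ s, f i t) a b := by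
  classical
  induction s using Finset.induction_on with
  | empty =>
    simpa using (LipschitzOnWith.absolutelyContinuousOnInterval (a := a) (b := b)
      ((LipschitzWith.const (0 : ℝ)).lipschitzOnWith))
  | insert i s hi ih =>
    simp only [Finset.sum_insert hi]
    exact (h i (Finset.mem_insert_self i s)).fun_add
      (ih fun j hj => h j (Finset.mem_insert_of_mem hj))

theorem absolutelyContinuous_apply {ι : Type*} [Fintype ι] {f : ℝ → ι → ℝ} {a b : ℝ}
    (h : AbsolutelyContinuousOnInterval f a b) (i : ι) :
    AbsolutelyContinuousOnInterval (fun t => f t i) a b := by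
  refine squeeze_zero (fun E => Finset.sum_nonneg fun _ _ => dist_nonneg) (fun E => ?_) h
  exact Finset.sum_le_sum fun j _ => dist_le_pi_dist _ _ i

variable {n : Type*} [Fintype n]

theorem absolutelyContinuous_quadForm (X : Matrix n n ℝ) {ξ : ℝ → n → ℝ} {a b : ℝ}
    (h : ∀ i, AbsolutelyContinuousOnInterval (fun t => ξ t i) a b) :
    AbsolutelyContinuousOnInterval (fun t => ξ t ⬝ᵥ X *ᵥ ξ t) a b :=
  absolutelyContinuous_sum _ fun i _ => (h i).fun_mul
    (absolutelyContinuous_sum _ fun j _ => (h j).const_mul (X i j))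

theorem hasDerivAt_quadForm {X : Matrix n n ℝ} (hX : X.IsSymm) {ξ : ℝ → n → ℝ} {F : n → ℝ} {t : ℝ}
    (h : ∀ i, HasDerivAt (fun t => ξ t i) (F i) t) :
    HasDerivAt (fun t => ξ t ⬝ᵥ X *ᵥ ξ t) (2 * (ξ t ⬝ᵥ X *ᵥ F)) t := by
  have h1 : HasDerivAt (fun t => ∑ i, ξ t i * ∑ j, X i j * ξ t j)
      (∑ i, (F i * (∑ j, X i j * ξ t j) + ξ t i * ∑ j, X i j * F j)) t :=
    HasDerivAt.fun_sum fun i _ => (h i).mul (HasDerivAt.fun_sum fun j _ => (h j).const_mul (X i j))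
  refine h1.congr_deriv ?_
  have h2 : F ⬝ᵥ X *ᵥ ξ t = ξ t ⬝ᵥ X *ᵥ F := by
    rw [dotProduct_mulVec, dotProduct_comm, ← mulVec_transpose, hX.eq]
  rw [Finset.sum_add_distrib, two_mul]
  nth_rewrite 1 [← h2]
  rfl

theorem posDef_exists_lower_bound {X : Matrix n n ℝ} (hX : X.PosDef) :
    ∃ c : ℝ, 0 < c ∧ ∀ v : n → ℝ, c * ‖v‖ ^ 2 ≤ v ⬝ᵥ X *ᵥ v := by
  have hcont : Continuous fun v : n → ℝ => v ⬝ᵥ X *ᵥ v := by fun_prop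
  have hpos : ∀ v : n → ℝ, v ≠ 0 → 0 < v ⬝ᵥ X *ᵥ v := fun v hv => by
    simpa using hX.dotProduct_mulVec_pos hv
  rcases (Metric.sphere (0 : n → ℝ) 1).eq_empty_or_nonempty with hemp | hne
  · refine ⟨1, one_pos, fun v => ?_⟩
    by_cases hv : v = 0
    · simp [hv]
    · have : ‖v‖⁻¹ • v ∈ Metric.sphere (0 : n → ℝ) 1 := by
        simp [norm_smul, norm_ne_zero_iff.2 hv]
      rw [hemp] at this
      exact this.elim
  · obtain ⟨v₀, hv₀, hmin⟩ := (isCompact_sphere (0 : n → ℝ) 1).exists_isMinOn hne hcont.continuousOn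
    refine ⟨v₀ ⬝ᵥ X *ᵥ v₀, hpos v₀ ?_, fun v => ?_⟩
    · rintro rfl
      simp at hv₀
    · by_cases hv : v = 0
      · simp [hv]
      · have hn : ‖v‖ ≠ 0 := norm_ne_zero_iff.2 hv
        have hmem : ‖v‖⁻¹ • v ∈ Metric.sphere (0 : n → ℝ) 1 := by
          simp [norm_smul, hn]
        have h := hmin hmem
        simp only [mem_ofPred_eq, mulVec_smul, dotProduct_smul, smul_dotProduct, smul_eq_mul] at h
        have h2 := mul_le_mul_of_nonneg_right h (sq_nonneg ‖v‖)
        refine h2.trans_eq ?_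
        field_simp

theorem intervalIntegrable_continuous_comp {E : Type*} [NormedAddCommGroup E] [ProperSpace E]
    {Y : ℝ → E} (hY : AEStronglyMeasurable Y volume) (hb : ∀ T, ∃ R, ∀ t ≤ T, ‖Y t‖ ≤ R)
    {F : E → ℝ} (hF : Continuous F) (a b : ℝ) :
    IntervalIntegrable (fun t => F (Y t)) volume a b := by
  obtain ⟨R, hR⟩ := hb (max a b)
  obtain ⟨C, hC⟩ := (isCompact_closedBall (0 : E) R).exists_bound_of_continuousOn hF.continuousOn
  rw [intervalIntegrable_iff]
  refine Measure.integrableOn_of_bounded (M := C) (by simp [uIoc])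
    (hF.comp_aestronglyMeasurable hY) ?_
  refine (ae_restrict_iff' measurableSet_uIoc).2 (Filter.Eventually.of_forall fun t ht => ?_)
  exact hC _ (by simpa using hR t ht.2)

end Analysis

/-! ### Equilibria and output bound of the network -/

section Plant

variable {nρ nx d N : ℕ} (G : Vehicle nρ nx d)

theorem blockDiagonal_mulVec_apply {a b o : Type*} [Fintype b] [Fintype o] [DecidableEq o]
    (M : o → Matrix a b ℝ) (v : b × o → ℝ) (c : a) (i : o) :
    (blockDiagonal M *ᵥ v) (c, i) = (M i *ᵥ fun s => v (s, i)) c := by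
  simp only [mulVec, dotProduct, Fintype.sum_prod_type, blockDiagonal_apply, ite_mul, zero_mul]
  refine Finset.sum_congr rfl fun s _ => ?_
  simp

/-- The equilibria of the agents stack to one of the network that works for all parameter values. -/
theorem exists_network_equilibrium {Par : Set (Fin nρ → ℝ)} (hEq : G.HasEquilibria Par)
    (ystar : NetPos N d → ℝ) :
    ∃ ηs : NetState N nx d → ℝ, ∀ r : Fin N → Fin nρ → ℝ, (∀ i, r i ∈ Par) →
      G.Ahat r *ᵥ ηs = 0 ∧ G.Chat r *ᵥ ηs = ystar := by
  choose η hη using hEq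
  refine ⟨fun s => η (fun a => ystar (a, s.2)) s.1, fun r hr => ⟨?_, ?_⟩⟩
  · funext ⟨s, i⟩
    rw [Vehicle.Ahat, blockDiagonal_mulVec_apply]
    exact congrFun (hη (fun a => ystar (a, i)) (r i) (hr i)).1 s
  · funext ⟨s, i⟩
    rw [Vehicle.Chat, blockDiagonal_mulVec_apply]
    exact congrFun (hη (fun a => ystar (a, i)) (r i) (hr i)).2 s

theorem Chat_bounded {Par : Set (Fin nρ → ℝ)}
    (hC : ∃ K : ℝ, ∀ r ∈ Par, ∀ i j, |G.C r i j| ≤ K) :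
    ∃ K : ℝ, 0 ≤ K ∧ ∀ r : Fin N → Fin nρ → ℝ, (∀ i, r i ∈ Par) → ∀ v : NetState N nx d → ℝ,
      ‖(WithLp.toLp 2 (G.Chat r *ᵥ v) : PosSpace N d)‖ ≤ K * ‖v‖ := by
  obtain ⟨K, hK⟩ := hC
  let E := (EuclideanSpace.equiv (NetPos N d) ℝ).symm.toContinuousLinearMap
  refine ⟨‖E‖ * (Fintype.card (NetState N nx d) * |K|), by positivity, fun r hr v => ?_⟩
  have h1 : ‖E (G.Chat r *ᵥ v)‖ ≤ ‖E‖ * ‖G.Chat r *ᵥ v‖ := E.le_opNorm _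
  refine h1.trans ?_
  rw [mul_assoc]
  refine mul_le_mul_of_nonneg_left ?_ (norm_nonneg _)
  refine (pi_norm_le_iff_of_nonneg (by positivity)).2 fun c => ?_
  have hent : ∀ s, |G.Chat r c s| ≤ |K| := by
    intro s
    rw [Vehicle.Chat, blockDiagonal_apply]
    split_ifs with h
    · rcases s with ⟨s | s, i⟩
      · exact (hK _ (hr _) _ _).trans (le_abs_self K)
      · simp [Vehicle.CG]
    · simp
  calc ‖(G.Chat r *ᵥ v) c‖ ≤ ∑ s, ‖G.Chat r c s * v s‖ := norm_sum_le _ _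
    _ ≤ ∑ _s : NetState N nx d, |K| * ‖v‖ := by
        refine Finset.sum_le_sum fun s _ => ?_
        rw [norm_mul]
        exact mul_le_mul (hent s) (norm_le_pi_norm v s) (norm_nonneg _) (abs_nonneg _)
    _ = _ := by simp; ring

end Plant

/-! ### Exponential convergence -/

section Convergence

variable {nρ nx d N k : ℕ} {G : Vehicle nρ nx d} {Par : Set (Fin nρ → ℝ)}

/-- The deviation `y - y⋆` of the output on `[0, ∞)`, set to zero at negative times, where a trajectory
carries no information, so that it is measurable and locally bounded on all of `ℝ`. -/
def shiftedOutput {N d : ℕ} (y : ℝ → PosSpace N d) (ystar : PosSpace N d) : ℝ → PosSpace N d :=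
  indicator (Ici 0) fun t => y t - ystar

theorem shiftedOutput_of_nonneg (y : ℝ → PosSpace N d) (ystar : PosSpace N d) {t : ℝ} (ht : 0 ≤ t) :
    shiftedOutput y ystar t = y t - ystar := indicator_of_mem (mem_Ici.2 ht) _

theorem inner_eq_dotProduct {ι : Type*} [Fintype ι] (a b : EuclideanSpace ℝ ι) :
    inner ℝ a b = a.ofLp ⬝ᵥ b.ofLp := by
  rw [EuclideanSpace.inner_eq_star_dotProduct, star_trivial, dotProduct_comm]

theorem shiftedOutput_bounded {f : PosSpace N d → ℝ} {η : ℝ → NetState N nx d → ℝ}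
    {u e y : ℝ → PosSpace N d} {ρ : ℝ → Fin N → Fin nρ → ℝ}
    (hC : ∃ K : ℝ, ∀ r ∈ Par, ∀ i j, |G.C r i j| ≤ K)
    (htr : G.IsTrajectory Par f η u e y ρ) (ystar : PosSpace N d) (T : ℝ) :
    ∃ R, ∀ t ≤ T, ‖shiftedOutput y ystar t‖ ≤ R := by
  obtain ⟨K, hK0, hK⟩ := Chat_bounded (N := N) G hC
  obtain ⟨R, hR⟩ := (htr.absolutelyContinuous |T| (abs_nonneg T)).exists_bound
  rw [uIcc_of_le (abs_nonneg T)] at hR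
  have hR0 : 0 ≤ R := (norm_nonneg _).trans (hR 0 ⟨le_rfl, abs_nonneg T⟩)
  refine ⟨K * R + ‖ystar‖, fun t ht => ?_⟩
  by_cases h0 : 0 ≤ t
  · rw [shiftedOutput_of_nonneg _ _ h0, htr.output t h0]
    refine (norm_sub_le _ _).trans (add_le_add_left ?_ _)
    exact (hK _ (htr.param_mem t h0) _).trans
      (mul_le_mul_of_nonneg_left (hR t ⟨h0, ht.trans (le_abs_self T)⟩) hK0)
  · rw [shiftedOutput, indicator_of_notMem (by simpa using h0), norm_zero]
    positivity

theorem shiftedOutput_measurable {y : ℝ → PosSpace N d}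
    (hy : AEStronglyMeasurable y (volume.restrict (Ici (0 : ℝ)))) (ystar : PosSpace N d) :
    AEStronglyMeasurable (shiftedOutput y ystar) volume :=
  (aestronglyMeasurable_indicator_iff measurableSet_Ici).2 (hy.sub aestronglyMeasurable_const)

/-- The state of `Π` started at zero and driven by `w₁` in the first channel and `w₂` in the second. -/
def multState {N d : ℕ} (k : ℕ) (α : ℝ) (w₁ w₂ : ℝ → NetPos N d → ℝ) (t : ℝ) :
    (Fin (k + 1) ⊕ Fin (k + 1)) × NetPos N d → ℝ := fun c =>
  Sum.elim (fun j : Fin (k + 1) => filterState (1 + 2 * α) (fun s => w₁ s c.2) j t)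
    (fun j : Fin (k + 1) => filterState (1 + 2 * α) (fun s => w₂ s c.2) j t) c.1

/-- `multState` solves the state equation of `Π` at almost every time. The values `y` and `u` at that time
are quantified inside, so that the exceptional null set does not depend on them. -/
theorem multState_ae_hasDerivAt {m L α : ℝ} {w₁ w₂ : ℝ → NetPos N d → ℝ}
    (hw₁ : ∀ i a b, IntervalIntegrable (fun t => w₁ t i) volume a b)
    (hw₂ : ∀ i a b, IntervalIntegrable (fun t => w₂ t i) volume a b) :
    ∀ᵐ t, ∀ y u : NetPos N d → ℝ, (∀ i, w₁ t i = u i - m * y i) → (∀ i, w₂ t i = L * y i - u i) →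
      ∀ c, HasDerivAt (fun t => multState k α w₁ w₂ t c)
        ((PiA (k + 1) α N d *ᵥ multState k α w₁ w₂ t +
          PiB (k + 1) m L N d *ᵥ Sum.elim y u) c) t := by
  have h₁ := ae_all_iff.2 fun i => filterState_zero_ae_hasDerivAt (c := 1 + 2 * α) (hw₁ i)
  have h₂ := ae_all_iff.2 fun i => filterState_zero_ae_hasDerivAt (c := 1 + 2 * α) (hw₂ i)
  filter_upwards [h₁, h₂] with t ht₁ ht₂ y u e₁ e₂
  rintro ⟨j | j, i⟩ <;> refine Fin.cases ?_ (fun j => ?_) j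
  · rw [(PiA_PiB_mulVec_zero k m L α N d (multState k α w₁ w₂ t) y u i).1, ← e₁]
    exact ht₁ i
  · rw [(PiA_PiB_mulVec_succ k m L α N d (multState k α w₁ w₂ t) y u j i).1]
    exact filterState_succ_hasDerivAt (hw₁ i) j t
  · rw [(PiA_PiB_mulVec_zero k m L α N d (multState k α w₁ w₂ t) y u i).2, ← e₂]
    exact ht₂ i
  · rw [(PiA_PiB_mulVec_succ k m L α N d (multState k α w₁ w₂ t) y u j i).2]
    exact filterState_succ_hasDerivAt (hw₂ i) j t

/-- Integrated Lyapunov estimate: if `V = ξᵀ X ξ` satisfies `V' + 2 α V ≤ -2 S` almost everywhere and the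
supply rate `S` has nonnegative weighted integral, then `exp (2 α T) V(T) ≤ V(0)`. -/
theorem exp_quadForm_le_of_dissipation {n : Type*} [Fintype n] {X : Matrix n n ℝ} (hX : X.IsSymm)
    {ξ : ℝ → n → ℝ} {S : ℝ → ℝ} {α T : ℝ} (hT : 0 ≤ T)
    (hac : ∀ i, AbsolutelyContinuousOnInterval (fun t => ξ t i) 0 T)
    (hd : ∀ᵐ t, t ∈ Ioc 0 T → ∃ F : n → ℝ, (∀ i, HasDerivAt (fun t => ξ t i) (F i) t) ∧
      ξ t ⬝ᵥ X *ᵥ F + α * (ξ t ⬝ᵥ X *ᵥ ξ t) + S t ≤ 0)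
    (hSi : IntervalIntegrable (fun t => Real.exp (2 * α * t) * S t) volume 0 T)
    (hS : 0 ≤ ∫ t in (0 : ℝ)..T, Real.exp (2 * α * t) * S t) :
    Real.exp (2 * α * T) * (ξ T ⬝ᵥ X *ᵥ ξ T) ≤ ξ 0 ⬝ᵥ X *ᵥ ξ 0 := by
  have hVac := (absolutelyContinuous_exp (2 * α) T).fun_mul (absolutelyContinuous_quadForm X hac)
  have hftc := hVac.integral_deriv_eq_sub
  have hle : ∫ t in (0 : ℝ)..T, deriv (fun t => Real.exp (2 * α * t) * (ξ t ⬝ᵥ X *ᵥ ξ t)) t ≤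
      ∫ t in (0 : ℝ)..T, -2 * (Real.exp (2 * α * t) * S t) := by
    refine intervalIntegral.integral_mono_ae_restrict hT hVac.intervalIntegrable_deriv
      (hSi.const_mul _) ?_
    rw [Filter.EventuallyLE, Measure.restrict_congr_set Ioc_ae_eq_Icc.symm,
      ae_restrict_iff' measurableSet_Ioc]
    filter_upwards [hd] with t ht htm
    obtain ⟨F, hF, hFS⟩ := ht htm
    have h1 : HasDerivAt (fun t => Real.exp (2 * α * t)) (Real.exp (2 * α * t) * (2 * α * 1)) t :=
      ((hasDerivAt_id t).const_mul (2 * α)).exp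
    rw [(h1.fun_mul (hasDerivAt_quadForm hX hF)).deriv]
    have := mul_le_mul_of_nonneg_left hFS (Real.exp_pos (2 * α * t)).le
    linarith
  rw [hftc, intervalIntegral.integral_const_mul] at hle
  simp only [mul_zero, Real.exp_zero, one_mul] at hle
  linarith

/-- Exponential convergence of the output of a trajectory to a critical point of `f`. -/
theorem norm_sub_le_exp {m L δ α lam : ℝ} (hmL : m ≤ L)
    (hC : ∃ K : ℝ, ∀ r ∈ Par, ∀ i j, |G.C r i j| ≤ K)
    (hEq : G.HasEquilibria Par)
    {X : Matrix (FullState (k + 1) N nx d) (FullState (k + 1) N nx d) ℝ}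
    {P : Matrix (MultOut (k + 1)) (MultOut (k + 1)) ℝ}
    (hX : X.PosDef) (hP : P ∈ zamesFalb k) (hα : 0 < α) (hlam : 0 ≤ lam)
    (hLMI : ∀ r : Fin N → Fin nρ → ℝ, (∀ i, r i ∈ Par) →
      (-lmiMatrix G (k + 1) m L α δ r X P lam).PosSemidef)
    {f : PosSpace N d → ℝ} (hf : f ∈ SmL m L) {ystar : PosSpace N d}
    (hystar : gradient f ystar = 0)
    {η : ℝ → NetState N nx d → ℝ} {u e y : ℝ → PosSpace N d}
    {ρ : ℝ → Fin N → Fin nρ → ℝ} (htr : G.IsTrajectory Par f η u e y ρ)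
    (he : ∀ t, 0 ≤ t → ‖e t‖ ≤ δ * ‖gradient f (y t)‖) :
    ∃ κ : ℝ, 0 ≤ κ ∧ ∀ t, 0 ≤ t → ‖y t - ystar‖ ≤ κ * Real.exp (-α * t) := by
  obtain ⟨H, P₁, P₃, X₁, X₃, At, Bt, Ct, Dt, hreal, hH, hX₁, hX₃, hpos₁, hpos₃, rfl⟩ := hP
  have hp₁ := fun t (ht : (0 : ℝ) ≤ t) => zamesFalb_poly_nonneg hreal hX₁ P₁ hpos₁ ht
  have hp₃ := fun t (ht : (0 : ℝ) ≤ t) => zamesFalb_poly_nonneg hreal hX₃ P₃ hpos₃ ht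
  have hH' : ∑ j, P₁ j + ∑ j, P₃ j ≤ H := by
    simp only [Anu_inv_mul_Bnu, mul_neg, mul_one, Finset.sum_neg_distrib,
      Finset.sum_add_distrib] at hH
    linarith
  have hXs : X.IsSymm := by simpa [IsHermitian, IsSymm] using hX.isHermitian
  obtain ⟨ηs, hηs⟩ := exists_network_equilibrium (N := N) G hEq ystar.ofLp
  obtain ⟨c, hc0, hc⟩ := posDef_exists_lower_bound hX
  obtain ⟨K, hK0, hK⟩ := Chat_bounded (N := N) G hC
  obtain ⟨q, hqc, hq0, hq1, hq2⟩ := SmL.exists_storage hmL hf hystar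
  have hgc := SmL.continuous_gradient hf
  have hYm := shiftedOutput_measurable htr.measurable_output ystar
  have hYb := shiftedOutput_bounded hC htr ystar
  have hint : ∀ {F : PosSpace N d → ℝ}, Continuous F → ∀ a b, IntervalIntegrable
      (fun t => F (shiftedOutput y ystar t)) volume a b :=
    fun hF a b => intervalIntegrable_continuous_comp hYm hYb hF a b
  set Y := shiftedOutput y ystar with hY
  let W₁ : PosSpace N d → PosSpace N d := fun x => gradient f (x + ystar) - m • x
  let W₂ : PosSpace N d → PosSpace N d := fun x => L • x - gradient f (x + ystar)
  have hW₁ : Continuous W₁ := by fun_prop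
  have hW₂ : Continuous W₂ := by fun_prop
  let w₁ : ℝ → NetPos N d → ℝ := fun t => (W₁ (Y t)).ofLp
  let w₂ : ℝ → NetPos N d → ℝ := fun t => (W₂ (Y t)).ofLp
  have hw₁ : ∀ i a b, IntervalIntegrable (fun t => w₁ t i) volume a b :=
    fun i => hint (F := fun x => W₁ x i) (by fun_prop)
  have hw₂ : ∀ i a b, IntervalIntegrable (fun t => w₂ t i) volume a b :=
    fun i => hint (F := fun x => W₂ x i) (by fun_prop)
  have hw₁₂ : ∀ a b, IntervalIntegrable (fun t => w₁ t ⬝ᵥ w₂ t) volume a b :=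
    hint (F := fun x => (W₁ x).ofLp ⬝ᵥ (W₂ x).ofLp) (by fun_prop)
  let Q : ℝ → ℝ := fun t => q (Y t + ystar)
  have hQ : ∀ a b, IntervalIntegrable Q volume a b :=
    hint (F := fun x => q (x + ystar)) (by fun_prop)
  have hQ0 : ∀ t, 0 ≤ Q t := fun t => hq0 _
  have hQ1 : ∀ t, Q t ≤ w₁ t ⬝ᵥ w₂ t := fun t => by
    have := hq1 (Y t + ystar)
    rwa [add_sub_cancel_right, inner_eq_dotProduct] at this
  have hQ2 : ∀ t s, Q t - Q s ≤ w₁ t ⬝ᵥ w₂ t - w₁ t ⬝ᵥ w₂ s := fun t s => by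
    have := hq2 (Y t + ystar) (Y s + ystar)
    rwa [add_sub_cancel_right, add_sub_cancel_right, inner_eq_dotProduct,
      inner_eq_dotProduct] at this
  let ψ := multState k α w₁ w₂
  let ξ : ℝ → FullState (k + 1) N nx d → ℝ := fun t => Sum.elim (η t - ηs) (ψ t)
  -- Since `H ≥ ∑ P₁ + ∑ P₃`, the multiplier dominates the sum of a causal part with weights `P₃` and
  -- an anticausal part, in which the channels exchange roles, with weights `P₁`.
  let S₃ : ℝ → ℝ := fun t => (∑ j, P₃ j) * (w₁ t ⬝ᵥ w₂ t) - ∑ i, w₁ t i *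
    ∑ j : Fin (k + 1), P₃ j * filterState (1 + 2 * α) (fun s => w₂ s i) j t
  let S₁ : ℝ → ℝ := fun t => (∑ j, P₁ j) * (w₂ t ⬝ᵥ w₁ t) - ∑ i, w₂ t i *
    ∑ j : Fin (k + 1), P₁ j * filterState (1 + 2 * α) (fun s => w₁ s i) j t
  have bound : ∀ T, 0 ≤ T → Real.exp (2 * α * T) * (ξ T ⬝ᵥ X *ᵥ ξ T) ≤ ξ 0 ⬝ᵥ X *ᵥ ξ 0 := by
    intro T hT
    obtain ⟨i₃, n₃⟩ := zamesFalb_iqc P₃ hp₃ hα.le w₁ w₂ Q hw₁ hw₂ hw₁₂ hQ hQ0 hQ1 hQ2 hT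
    -- With the channels exchanged, `w₁ ⬝ᵥ w₂ - q` takes over as storage.
    obtain ⟨i₁, n₁⟩ := zamesFalb_iqc P₁ hp₁ hα.le w₂ w₁ (fun t => w₁ t ⬝ᵥ w₂ t - Q t) hw₂ hw₁
      (by simpa only [dotProduct_comm] using hw₁₂) (fun a b => (hw₁₂ a b).sub (hQ a b))
      (fun t => by linarith [hQ1 t]) (fun t => by rw [dotProduct_comm]; linarith [hQ0 t])
      (fun t s => by
        have := hQ2 s t
        rw [dotProduct_comm (w₂ t), dotProduct_comm (w₂ t)]
        linarith) hT
    refine exp_quadForm_le_of_dissipation (S := fun t => S₃ t + S₁ t) hXs hT ?_ ?_ ?_ ?_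
    · rintro (s | ⟨j | j, i⟩)
      · have h1 := absolutelyContinuous_apply (htr.absolutelyContinuous T hT) s
        have h2 : AbsolutelyContinuousOnInterval (fun _ : ℝ => ηs s) 0 T :=
          LipschitzOnWith.absolutelyContinuousOnInterval (LipschitzWith.const _).lipschitzOnWith
        exact h1.fun_sub h2
      · exact filterState_absolutelyContinuous (hw₁ i) j T
      · exact filterState_absolutelyContinuous (hw₂ i) j T
    · have hdyn := (ae_restrict_iff' measurableSet_Ioi).1 htr.dynamics
      have hmult := multState_ae_hasDerivAt (k := k) (m := m) (L := L) (α := α) hw₁ hw₂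
      filter_upwards [hdyn, hmult] with t hη hψ ht
      have ht0 : 0 ≤ t := ht.1.le
      have hr := htr.param_mem t ht0
      have hYt : Y t = y t - ystar := shiftedOutput_of_nonneg y ystar ht0
      have hgrad : gradient f (Y t + ystar) = u t := by
        rw [hYt, sub_add_cancel, htr.input t ht0]
      have hY' : (Y t).ofLp = G.Chat (ρ t) *ᵥ (η t - ηs) := by
        rw [mulVec_sub, (hηs _ hr).2, hYt, htr.output t ht0]
        rfl
      have e₁ : ∀ i, w₁ t i = (u t).ofLp i - m * (Y t).ofLp i := fun i => by
        simp [w₁, W₁, hgrad]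
      have e₂ : ∀ i, w₂ t i = L * (Y t).ofLp i - (u t).ofLp i := fun i => by
        simp [w₂, W₂, hgrad]
      have hnoise : (e t).ofLp ⬝ᵥ (e t).ofLp ≤ δ ^ 2 * ((u t).ofLp ⬝ᵥ (u t).ofLp) := by
        rw [← inner_eq_dotProduct, ← inner_eq_dotProduct, real_inner_self_eq_norm_sq,
          real_inner_self_eq_norm_sq, htr.input t ht0, ← mul_pow]
        exact pow_le_pow_left₀ (norm_nonneg _) (he t ht0) 2
      have hdis := lmi_dissipation G hXs hlam (hLMI (ρ t) hr) (η t - ηs) (ψ t) (u t).ofLp (e t).ofLp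
        (Y t).ofLp hY' hnoise
      refine ⟨_, ?_, le_trans (add_le_add_right ?_ _) hdis⟩
      · rintro (s | c)
        · have h1 := (hasDerivAt_pi.1 (hη ht.1) s).sub_const (ηs s)
          refine h1.congr_deriv ?_
          simp [mulVec_sub, (hηs _ hr).1]
        · exact hψ (Y t).ofLp (u t).ofLp e₁ e₂ c
      · have hw0 : 0 ≤ w₁ t ⬝ᵥ w₂ t := (hQ0 t).trans (hQ1 t)
        have h1 := mul_le_mul_of_nonneg_right hH' hw0
        simp only [← e₁, ← e₂, Finset.sum_sub_distrib, ← Finset.mul_sum]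
        have h2 : S₃ t + S₁ t = (∑ j, P₁ j + ∑ j, P₃ j) * (w₁ t ⬝ᵥ w₂ t) -
            (∑ i, w₁ t i * ∑ j, P₃ j * ψ t (Sum.inr j, i)) -
            ∑ i, w₂ t i * ∑ j, P₁ j * ψ t (Sum.inl j, i) := by
          simp only [S₃, S₁, dotProduct_comm (w₂ t)]
          simp only [ψ, multState, Sum.elim_inl, Sum.elim_inr]
          ring
        rw [h2]
        exact sub_le_sub_right (sub_le_sub_right h1 _) _
    · simp only [mul_add]
      exact i₃.add i₁
    · simp only [mul_add]
      rw [intervalIntegral.integral_add i₃ i₁]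
      exact add_nonneg n₃ n₁
  refine ⟨K * Real.sqrt ((ξ 0 ⬝ᵥ X *ᵥ ξ 0) / c), by positivity, fun t ht => ?_⟩
  have h1 := bound t ht
  have h2 := hc (ξ t)
  have hηξ : ‖η t - ηs‖ ≤ ‖ξ t‖ := (pi_norm_le_iff_of_nonneg (norm_nonneg _)).2 fun s =>
    norm_le_pi_norm (ξ t) (Sum.inl s)
  have hξ : ‖ξ t‖ ≤ Real.sqrt ((ξ 0 ⬝ᵥ X *ᵥ ξ 0) / c) * Real.exp (-α * t) := by
    have h3 : (‖ξ t‖ * Real.exp (α * t)) ^ 2 ≤ (ξ 0 ⬝ᵥ X *ᵥ ξ 0) / c := by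
      rw [le_div_iff₀ hc0, mul_pow, ← Real.exp_nat_mul]
      have h4 := mul_le_mul_of_nonneg_left h2 (Real.exp_pos (2 * α * t)).le
      have h5 : Real.exp (((2 : ℕ) : ℝ) * (α * t)) = Real.exp (2 * α * t) := by
        congr 1; push_cast; ring
      rw [h5]
      linarith
    have h4 := Real.le_sqrt_of_sq_le h3
    have h5 := mul_le_mul_of_nonneg_right h4 (Real.exp_pos (-α * t)).le
    rwa [mul_assoc, ← Real.exp_add, show α * t + -α * t = 0 by ring, Real.exp_zero, mul_one] at h5
  have hYt : y t - ystar = WithLp.toLp 2 (G.Chat (ρ t) *ᵥ (η t - ηs)) := by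
    rw [mulVec_sub, (hηs _ (htr.param_mem t ht)).2, htr.output t ht]
    rfl
  rw [hYt, mul_assoc]
  exact (hK _ (htr.param_mem t ht) _).trans (mul_le_mul_of_nonneg_left (hηξ.trans hξ) hK0)

end Convergence

end SourceSeeking

end

theorem theorem1 {nρ nx d N k : ℕ} (G : SourceSeeking.Vehicle nρ nx d) (Par : Set (Fin nρ → ℝ))
    (m L δ : ℝ) (hm : 0 < m) (hmL : m ≤ L) (hδ : 0 ≤ δ)
    (hC : ∃ K : ℝ, ∀ r ∈ Par, ∀ i j, |G.C r i j| ≤ K)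
    (hEq : G.HasEquilibria Par)
    (X : Matrix (SourceSeeking.FullState (k + 1) N nx d) (SourceSeeking.FullState (k + 1) N nx d) ℝ)
    (P : Matrix (SourceSeeking.MultOut (k + 1)) (SourceSeeking.MultOut (k + 1)) ℝ)
    (α lam : ℝ) (hX : X.PosDef) (hP : P ∈ SourceSeeking.zamesFalb k) (hα : 0 < α) (hlam : 0 ≤ lam)
    (hLMI : ∀ r : Fin N → Fin nρ → ℝ, (∀ i, r i ∈ Par) →
      (-SourceSeeking.lmiMatrix G (k + 1) m L α δ r X P lam).PosSemidef)
    (f : SourceSeeking.PosSpace N d → ℝ) (hf : f ∈ SourceSeeking.SmL m L) :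
    ∃ ystar : SourceSeeking.PosSpace N d,
      ((∀ y, f ystar ≤ f y) ∧ ∀ z, (∀ y, f z ≤ f y) → z = ystar) ∧
      ∀ (η : ℝ → SourceSeeking.NetState N nx d → ℝ) (u e y : ℝ → SourceSeeking.PosSpace N d)
        (ρ : ℝ → Fin N → Fin nρ → ℝ),
        G.IsTrajectory Par f η u e y ρ →
        (∀ t, 0 ≤ t → ‖e t‖ ≤ δ * ‖gradient f (y t)‖) →
        ∃ κ : ℝ, 0 ≤ κ ∧ ∀ t, 0 ≤ t → ‖y t - ystar‖ ≤ κ * Real.exp (-α * t) := by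
  obtain ⟨ystar, hmin, huniq⟩ := SourceSeeking.SmL.exists_minimizer hm hf
  exact ⟨ystar, ⟨hmin, huniq⟩, fun η u e y ρ htr he =>
    SourceSeeking.norm_sub_le_exp hmL hC hEq hX hP hα hlam hLMI hf
      (SourceSeeking.SmL.gradient_eq_zero hmin) htr he⟩
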